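/- Let $\mu>0$, $\kappa=\sqrt{\mu/3}$, and let $\mathcal K^0_\mu(x)=\frac1\kappa J_0\!\left(\frac x\kappa\right)$ for $x\ge 0$, where $J_0(x)=\frac1\pi\int_0^\pi\cos(x\sin\theta)\,d\theta$ is the Bessel function; write $(\mathcal K^0_\mu*_x v)(x)=\int_0^x\mathcal K^0_\mu(x-x')v(x')\,dx'$. For $a\in\mathbb R$ let $L^2_a(\mathbb R^+)$ be the space of real functions $v$ on $(0,\infty)$ with $|v|_{L^2_a}^2=\int_0^\infty e^{-2ax}|v(x)|^2dx<\infty$, and let $H^k_a(\mathbb R^+)$ be the space of those $v\in L^2_a$ whose weak derivatives up to order $k$ are in $L^2_a$, with norm $\sum_{l=0}^k|\partial_x^l v|_{L^2_a}$. With $\mathbb R^+_t=[0,\infty)$, set $$\mathbb X^n_a=\bigcap_{j=0}^n C^j\big(\mathbb R^+_t;H^{n-j}_a(\mathbb R^+_x)\big),\qquad \mathbb Y^n_a=\bigcap_{j=0}^n W^{j,1}_{\rm loc}\big(\mathbb R^+_t;H^{n-j}_a(\mathbb R^+_x)\big),$$ where $W^{j,1}_{\rm loc}(\mathbb R^+_t;E)$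 consists of the functions that are, with their weak time derivatives up to order $j$, in $L^1(0,T;E)$ for every $T>0$. Let $a>0$, $n=1$ or $2$, $f\in\mathbb Y^n_a$ and $u^{\rm in}\in H^n_a(\mathbb R^+)$. Then there exists a unique $u\in\mathbb X^n_a$ such that $$\partial_t u+\partial_x\big(\mathcal K^0_\mu*_x u\big)=f,\qquad u_{|t=0}=u^{\rm in}$$ (where $\partial_t u$ is the derivative of $t\mapsto u(t,\cdot)\in L^2_a$, $\partial_x$ is the weak derivative on $(0,\infty)$, and the equation holds for almost every $t>0$). Moreover, for all $t\ge0$, the boundary value of $u$ is $$u(t,0)=e^{-t/\kappa}\,u^{\rm in}(0)+\int_0^t e^{-(t-t')/\kappa}f(t',0)\,dt',$$ where the boundary values at $x=0$ are those of the representatives that are continuous on $[0,\infty)$, which exist for $u^{\rm in}$, for $u(t,\cdot)$ for all $t\ge0$, and for $f(t,\cdot)$ for almost every $t$, and the integrand is integrable on $(0,t)$. If in addition $f\in C^q(\mathbb R^+_t;H^n_a(\mathbb R^+_x))$ for some $q\in\mathbb N=\{0,1,2,\dots\}$, then $u\in C^{q+1}(\mathbb R^+_t;H^n_a(\mathbb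 R^+_x))$. -/

import Mathlib

open MeasureTheory Set Filter Topology
open scoped ENNReal ContDiff

namespace RLTransport

/-! ## The convolution kernel -/

/-- The Bessel function `J_n(x) = (1/π) ∫₀^π cos (n θ - x sin θ) dθ`. -/
noncomputable def besselJ (n : ℕ) (x : ℝ) : ℝ :=
  (1 / Real.pi) * ∫ θ in (0 : ℝ)..Real.pi, Real.cos ((n : ℝ) * θ - x * Real.sin θ)

/-- `κ = √(μ/3)`. -/
noncomputable def kappa (μ : ℝ) : ℝ := Real.sqrt (μ / 3)

/-- The kernel `𝒦⁰_μ(x) = (1/κ) J₀(x/κ)`. -/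
noncomputable def kernelK0 (μ : ℝ) (x : ℝ) : ℝ := (1 / kappa μ) * besselJ 0 (x / kappa μ)

/-- Causal convolution `(k * v)(x) = ∫₀ˣ k(x - y) v(y) dy`. -/
noncomputable def causalConv (k v : ℝ → ℝ) (x : ℝ) : ℝ := ∫ y in (0 : ℝ)..x, k (x - y) * v y

/-! ## Weighted spaces in the space variable -/

/-- The measure `e^{-2ax} dx` on `(0, ∞)`. -/
noncomputable def weightMeasure (a : ℝ) : Measure ℝ :=
  (volume.restrict (Ioi (0 : ℝ))).withDensity fun x => ENNReal.ofReal (Real.exp (-2 * a * x))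

/-- `L²_a(ℝ⁺)`, with norm `(∫₀^∞ e^{-2ax} |v(x)|² dx)^{1/2}`. -/
abbrev L2 (a : ℝ) : Type := Lp ℝ 2 (weightMeasure a)

/-- `h` is the weak (distributional) derivative of `g` on `(0, ∞)`. -/
def HasWeakDeriv (g h : ℝ → ℝ) : Prop :=
  LocallyIntegrableOn g (Ioi 0) ∧ LocallyIntegrableOn h (Ioi 0) ∧
    ∀ φ : ℝ → ℝ, ContDiff ℝ ∞ φ → HasCompactSupport φ → tsupport φ ⊆ Ioi 0 →
      ∫ x in Ioi (0 : ℝ), deriv φ x * g x = -∫ x in Ioi (0 : ℝ), φ x * h x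

theorem ae_weight_iff (a : ℝ) {p : ℝ → Prop} :
    (∀ᵐ x ∂weightMeasure a, p x) ↔ ∀ᵐ x ∂volume.restrict (Ioi (0 : ℝ)), p x := by
  have hm : Measurable fun x : ℝ => ENNReal.ofReal (Real.exp (-2 * a * x)) := by fun_prop
  rw [weightMeasure, ae_withDensity_iff hm]
  refine eventually_congr (Eventually.of_forall fun x => ?_)
  simp [Real.exp_pos]

theorem integral_weight (a : ℝ) (g : ℝ → ℝ) :
    ∫ x, g x ∂weightMeasure a = ∫ x in Ioi (0 : ℝ), Real.exp (-2 * a * x) * g x := by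
  rw [weightMeasure, integral_withDensity_eq_integral_toReal_smul (by fun_prop) (by simp)]
  refine integral_congr_ae (Eventually.of_forall fun x => ?_)
  simp only [smul_eq_mul]
  rw [ENNReal.toReal_ofReal (Real.exp_pos _).le]

theorem integrable_weight_iff (a : ℝ) (g : ℝ → ℝ) :
    Integrable g (weightMeasure a) ↔
      IntegrableOn (fun x => Real.exp (-2 * a * x) * g x) (Ioi (0 : ℝ)) := by
  rw [weightMeasure, integrable_withDensity_iff_integrable_smul₀' (by fun_prop) (by simp)]
  refine integrable_congr (Eventually.of_forall fun x => ?_)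
  simp only [smul_eq_mul]
  rw [ENNReal.toReal_ofReal (Real.exp_pos _).le]

theorem memLp_test (a : ℝ) {φ : ℝ → ℝ} (hφ : Continuous φ) (hc : HasCompactSupport φ) :
    MemLp (fun x => φ x * Real.exp (2 * a * x)) 2 (weightMeasure a) := by
  have : IsLocallyFiniteMeasure (weightMeasure a) := by
    unfold weightMeasure
    exact IsLocallyFiniteMeasure.withDensity_ofReal (by fun_prop)
  have h1 : Continuous fun x => φ x * Real.exp (2 * a * x) := by fun_prop
  exact h1.memLp_of_hasCompactSupport hc.mul_right

theorem integral_test_eq_inner {a : ℝ} {φ : ℝ → ℝ} (hφ : Continuous φ)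
    (hc : HasCompactSupport φ) (v : L2 a) :
    ∫ x in Ioi (0 : ℝ), φ x * v x = inner ℝ ((memLp_test a hφ hc).toLp _) v := by
  rw [MeasureTheory.L2.inner_def]
  have h1 : ∫ x, inner ℝ (((memLp_test a hφ hc).toLp _ : L2 a) x) (v x) ∂weightMeasure a
      = ∫ x, φ x * Real.exp (2 * a * x) * v x ∂weightMeasure a := by
    refine integral_congr_ae ?_
    filter_upwards [(memLp_test a hφ hc).coeFn_toLp] with x hx
    rw [hx]
    simp [mul_comm]
  rw [h1, integral_weight]
  refine integral_congr_ae (Eventually.of_forall fun x => ?_)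
  simp only
  have : Real.exp (-2 * a * x) * Real.exp (2 * a * x) = 1 := by
    rw [← Real.exp_add]; simp
  linear_combination -(φ x * v x) * this

theorem integrableOn_test {a : ℝ} {φ : ℝ → ℝ} (hφ : Continuous φ)
    (hc : HasCompactSupport φ) (v : L2 a) :
    IntegrableOn (fun x => φ x * v x) (Ioi (0 : ℝ)) := by
  have h1 : Integrable (fun x => φ x * Real.exp (2 * a * x) * v x) (weightMeasure a) :=
    MemLp.integrable_mul (memLp_test a hφ hc) (Lp.memLp v)
  rw [integrable_weight_iff] at h1
  refine (integrable_congr (Eventually.of_forall fun x => ?_)).1 h1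
  have : Real.exp (-2 * a * x) * Real.exp (2 * a * x) = 1 := by
    rw [← Real.exp_add]; simp
  linear_combination (φ x * v x) * this

theorem locallyIntegrableOn_L2 {a : ℝ} (v : L2 a) : LocallyIntegrableOn v (Ioi (0 : ℝ)) := by
  rw [locallyIntegrableOn_iff isOpen_Ioi.isLocallyClosed]
  intro K hK hKc
  obtain ⟨φ, hφ1, -, hφc, -⟩ := exists_continuous_one_zero_of_isCompact hKc
    isClosed_empty (disjoint_empty K)
  have h := (integrableOn_test φ.continuous hφc v).mono_set hK
  refine h.congr_fun_ae ?_
  filter_upwards [ae_restrict_mem hKc.measurableSet] with x hx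
  simp [hφ1 hx]

theorem HasWeakDeriv.congr {g g' h h' : ℝ → ℝ} (H : HasWeakDeriv g h)
    (hg : g =ᵐ[volume.restrict (Ioi (0 : ℝ))] g')
    (hh : h =ᵐ[volume.restrict (Ioi (0 : ℝ))] h') : HasWeakDeriv g' h' := by
  obtain ⟨h1, h2, h3⟩ := H
  have key : ∀ {p p' : ℝ → ℝ}, p =ᵐ[volume.restrict (Ioi (0 : ℝ))] p' →
      LocallyIntegrableOn p (Ioi 0) → LocallyIntegrableOn p' (Ioi 0) := by
    intro p p' hp hl
    rw [locallyIntegrableOn_iff isOpen_Ioi.isLocallyClosed] at hl ⊢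
    intro K hK hKc
    exact (hl K hK hKc).congr_fun_ae (ae_restrict_of_ae_restrict_of_subset hK hp)
  refine ⟨key hg h1, key hh h2, fun φ hφ hc hs => ?_⟩
  rw [integral_congr_ae (g := fun x => deriv φ x * g x)
      (by filter_upwards [hg] with x hx; rw [hx]),
    h3 φ hφ hc hs,
    integral_congr_ae (g := fun x => φ x * h' x) (by filter_upwards [hh] with x hx; rw [hx])]

/-- For elements of `L²_a` the weak derivative is a closed linear condition. -/
theorem hasWeakDeriv_L2_iff {a : ℝ} (v w : L2 a) :
    HasWeakDeriv v w ↔ ∀ (φ : ℝ → ℝ) (hφ : ContDiff ℝ ∞ φ) (hc : HasCompactSupport φ),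
      tsupport φ ⊆ Ioi 0 →
      inner ℝ ((memLp_test a (hφ.continuous_deriv (by simp)) hc.deriv).toLp _) v
        = -inner ℝ ((memLp_test a hφ.continuous hc).toLp _) w := by
  constructor
  · intro H φ hφ hc hs
    rw [← integral_test_eq_inner (hφ.continuous_deriv (by simp)) hc.deriv,
      ← integral_test_eq_inner hφ.continuous hc]
    exact H.2.2 φ hφ hc hs
  · intro H
    refine ⟨locallyIntegrableOn_L2 v, locallyIntegrableOn_L2 w, fun φ hφ hc hs => ?_⟩
    rw [integral_test_eq_inner (hφ.continuous_deriv (by simp)) hc.deriv,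
      integral_test_eq_inner hφ.continuous hc]
    exact H φ hφ hc hs

/-- The weighted Sobolev space `H^k_a(ℝ⁺)`. A function `v` is represented by the family
`(v, ∂ₓv, …, ∂ₓᵏv)` of its weak derivatives, all in `L²_a(ℝ⁺)` (the family is determined by `v`),
and the norm is `∑_{l ≤ k} |∂ₓˡ v|_{L²_a}`. -/
noncomputable def sobolevSpace (a : ℝ) (k : ℕ) :
    Submodule ℝ (PiLp 1 fun _ : Fin (k + 1) => L2 a) where
  carrier := {v | ∀ i : Fin k, HasWeakDeriv (v i.castSucc) (v i.succ)}
  add_mem' := by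
    intro v w hv hw i
    have h1 := (hasWeakDeriv_L2_iff _ _).1 (hv i)
    have h2 := (hasWeakDeriv_L2_iff _ _).1 (hw i)
    refine (hasWeakDeriv_L2_iff _ _).2 fun φ hφ hc hs => ?_
    rw [PiLp.add_apply, PiLp.add_apply, inner_add_right, inner_add_right, h1 φ hφ hc hs,
      h2 φ hφ hc hs]
    ring
  zero_mem' := by
    intro i
    refine (hasWeakDeriv_L2_iff _ _).2 fun φ hφ hc hs => ?_
    simp
  smul_mem' := by
    intro c v hv i
    have h1 := (hasWeakDeriv_L2_iff _ _).1 (hv i)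
    refine (hasWeakDeriv_L2_iff _ _).2 fun φ hφ hc hs => ?_
    rw [PiLp.smul_apply, PiLp.smul_apply, inner_smul_right, inner_smul_right, h1 φ hφ hc hs]
    simp

theorem isClosed_sobolevSpace (a : ℝ) (k : ℕ) :
    IsClosed (sobolevSpace a k : Set (PiLp 1 fun _ : Fin (k + 1) => L2 a)) := by
  have : (sobolevSpace a k : Set (PiLp 1 fun _ : Fin (k + 1) => L2 a)) =
      {v | ∀ (i : Fin k) (φ : ℝ → ℝ) (hφ : ContDiff ℝ ∞ φ) (hc : HasCompactSupport φ),
      tsupport φ ⊆ Ioi 0 →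
      inner ℝ ((memLp_test a (hφ.continuous_deriv (by simp)) hc.deriv).toLp _) (v i.castSucc)
        = -inner ℝ ((memLp_test a hφ.continuous hc).toLp _) (v i.succ)} := by
    ext v
    exact forall_congr' fun i => hasWeakDeriv_L2_iff _ _
  rw [this]
  simp only [ofPred_forall]
  refine isClosed_iInter fun i => isClosed_iInter fun φ => isClosed_iInter fun hφ =>
    isClosed_iInter fun hc => isClosed_iInter fun hs => ?_
  have hcont : ∀ j : Fin (k + 1), Continuous fun v : PiLp 1 (fun _ : Fin (k + 1) => L2 a) => v j :=
    fun j => PiLp.continuous_apply 1 _ j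
  exact isClosed_eq (continuous_const.inner (hcont _)) (continuous_const.inner (hcont _)).neg

/-- `H^k_a(ℝ⁺)` as a normed space. -/
abbrev H (a : ℝ) (k : ℕ) : Type := sobolevSpace a k

instance instCompleteSpaceH (a : ℝ) (k : ℕ) : CompleteSpace (H a k) :=
  (isClosed_sobolevSpace a k).completeSpace_coe

/-- The underlying element of `L²_a(ℝ⁺)` of an element of `H^k_a(ℝ⁺)`. -/
noncomputable def toL2 {a : ℝ} {k : ℕ} (v : H a k) : L2 a :=
  (v : PiLp 1 fun _ : Fin (k + 1) => L2 a) 0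

/-- `v ∈ H^k_a(ℝ⁺)`. -/
def MemH {a : ℝ} (k : ℕ) (v : L2 a) : Prop := ∃ V : H a k, toL2 V = v

/-- `v` has a representative that is continuous on `[0, ∞)` and takes the value `c` at `0`. -/
def HasTrace {a : ℝ} (v : L2 a) (c : ℝ) : Prop :=
  ∃ w : ℝ → ℝ, ContinuousOn w (Ici 0) ∧ v =ᵐ[volume.restrict (Ioi (0 : ℝ))] w ∧ w 0 = c

/-- The boundary value `v(0)` (meaningful when `HasTrace v c` for some, then unique, `c`). -/
noncomputable def trace {a : ℝ} (v : L2 a) : ℝ := Classical.epsilon (HasTrace v)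

theorem HasTrace.unique {a : ℝ} {v : L2 a} {c d : ℝ} (hc : HasTrace v c) (hd : HasTrace v d) :
    c = d := by
  obtain ⟨w, hw, hvw, rfl⟩ := hc
  obtain ⟨z, hz, hvz, rfl⟩ := hd
  have h : w =ᵐ[volume.restrict (Ici (0 : ℝ))] z := by
    rw [← restrict_Ioi_eq_restrict_Ici]
    exact hvw.symm.trans hvz
  exact Measure.eqOn_of_ae_eq h hw hz (by simp) self_mem_Ici

theorem HasTrace.trace_eq {a : ℝ} {v : L2 a} {c : ℝ} (hc : HasTrace v c) : trace v = c :=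
  (Classical.epsilon_spec (p := HasTrace v) ⟨c, hc⟩).unique hc

/-! ## Spaces of functions of time, on `[0, ∞)` -/

/-- The function `F'` is the weak derivative of `F` on `(0, ∞)`, for functions of time with values in the
Banach space `E`. -/
def HasWeakTimeDeriv {E : Type*} [NormedAddCommGroup E] [NormedSpace ℝ E] [CompleteSpace E]
    (F F' : ℝ → E) : Prop :=
  ∀ φ : ℝ → ℝ, ContDiff ℝ ∞ φ → HasCompactSupport φ → tsupport φ ⊆ Ioi 0 →
    ∫ t in Ioi (0 : ℝ), deriv φ t • F t = -∫ t in Ioi (0 : ℝ), φ t • F' t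

/-- `F ∈ W^{j,1}_loc(ℝ⁺; E)`: the function and its weak derivatives up to order `j` are
integrable on `(0, T)` for every `T > 0`. -/
def MemW1loc {E : Type*} [NormedAddCommGroup E] [NormedSpace ℝ E] [CompleteSpace E]
    (j : ℕ) (F : ℝ → E) : Prop :=
  ∃ D : ℕ → ℝ → E, D 0 = F ∧
    (∀ i ≤ j, ∀ T : ℝ, 0 < T → IntegrableOn (D i) (Ioo 0 T)) ∧
    ∀ i < j, HasWeakTimeDeriv (D i) (D (i + 1))

/-- `f ∈ W^{j,1}_loc(ℝ⁺; H^k_a(ℝ⁺))`, where `f` is defined up to equality for almost every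
time. -/
def MemWH {a : ℝ} (j k : ℕ) (f : ℝ → L2 a) : Prop :=
  ∃ F : ℝ → H a k, MemW1loc j F ∧ ∀ᵐ t ∂volume.restrict (Ioi (0 : ℝ)), toL2 (F t) = f t

/-- `u ∈ C^j(ℝ⁺; H^k_a(ℝ⁺))`, with `ℝ⁺ = [0, ∞)`. -/
def MemCH {a : ℝ} (j k : ℕ) (u : ℝ → L2 a) : Prop :=
  ∃ U : ℝ → H a k, ContDiffOn ℝ j U (Ici 0) ∧ ∀ t, 0 ≤ t → toL2 (U t) = u t

/-- `𝕏ⁿ_a = ⋂_{j ≤ n} C^j(ℝ⁺; H^{n-j}_a(ℝ⁺))`. -/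
def MemX {a : ℝ} (n : ℕ) (u : ℝ → L2 a) : Prop := ∀ j ≤ n, MemCH j (n - j) u

/-- `𝕐ⁿ_a = ⋂_{j ≤ n} W^{j,1}_loc(ℝ⁺; H^{n-j}_a(ℝ⁺))`. -/
def MemY {a : ℝ} (n : ℕ) (f : ℝ → L2 a) : Prop := ∀ j ≤ n, MemWH j (n - j) f

/-! ## The initial value problem -/

/-- `u` solves `∂ₜu + ∂ₓ(𝒦⁰_μ *ₓ u) = f`, `u(0) = u^in`: `∂ₜu` is the derivative of
`t ↦ u(t) ∈ L²_a`, and `∂ₓ` is the weak derivative on `(0, ∞)`, so that the equation reads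
`∂ₓ(𝒦⁰_μ *ₓ u(t)) = f(t) - ∂ₜu(t)`. It is required for almost every `t` since `f` is only
defined for almost every `t`. -/
def IsSolution {a : ℝ} (μ : ℝ) (f : ℝ → L2 a) (uin : L2 a) (u : ℝ → L2 a) : Prop :=
  u 0 = uin ∧ ∀ᵐ t ∂volume.restrict (Ioi (0 : ℝ)), ∃ ut : L2 a,
    HasDerivWithinAt u ut (Ici 0) t ∧
      HasWeakDeriv (causalConv (kernelK0 μ) (u t)) (fun x => f t x - ut x)

end RLTransport

open RLTransport

/-! The kernel `K = kernelK0 μ` is smooth with `K(0) = 1/κ`, so `A v = ∂ₓ(K * v) = v/κ + K' * v`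
loses no derivative. It is a bounded operator on `L²_a`: every derivative of `K` is bounded, and for
`a > 0` a weighted Hardy inequality bounds `v ↦ ∫₀ˣ |v|` on `L²_a` with norm at most `1/a`. The
problem is thus the linear equation `u' = f - A u` in a Banach space, solved by Duhamel's formula
with the exponential series of `A`.

Two facts transfer this to `H^k_a`, both from `isPrimitive_convDeriv`. The commutator is a boundary
term, `∂ₓ(A v) = A ∂ₓv + v(0) K'`, and `K'` and its derivatives are in `L²_a`; iterating, `A` is
bounded on every `H^k_a` (`convDerivH`). Moreover `(A v)(0) = v(0)/κ`, so the trace intertwines `A`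
with multiplication by `1/κ`. By `duhamel_intertwine`, the Duhamel solutions in the various `H^k_a`
are the same function, and the trace of the solution is the scalar Duhamel formula.

Time regularity is a bootstrap on `u' = f - A u`, started from the `C^j` representative of a
function in `W^{j+1,1}_loc`. For uniqueness, the difference of two solutions in `C¹(ℝ⁺; L²_a)`
satisfies `w' = -A w` almost everywhere, hence everywhere by continuity, so `exp(tA) w` is constant.
-/

namespace RLTransport

/-! ### Banach-valued functions on the half-line: primitives and weak derivatives -/

section Time

set_option linter.unusedSectionVars false

variable {E : Type*} [NormedAddCommGroup E] [NormedSpace ℝ E] [CompleteSpace E]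

/-- Fubini on the triangle `0 < y < z < R`. -/
theorem integral_triangle_swap {m : ℝ → ℝ → ℝ} (hm : Continuous (Function.uncurry m))
    {w : ℝ → E} {R : ℝ} (hR : 0 ≤ R) (hw : IntegrableOn w (Ioc 0 R)) :
    ∫ z in (0 : ℝ)..R, ∫ y in (0 : ℝ)..z, m z y • w y
      = ∫ y in (0 : ℝ)..R, (∫ z in y..R, m z y) • w y := by
  set ρ := volume.restrict (Ioc 0 R) with hρ
  set D : Set (ℝ × ℝ) := {p | p.2 ≤ p.1} with hD
  have hDm : MeasurableSet D := measurableSet_le measurable_snd measurable_fst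
  set f : ℝ → ℝ → E := fun z y => D.indicator (fun p => m p.1 p.2 • w p.2) (z, y) with hf
  obtain ⟨C, hC⟩ := ((isCompact_Icc (a := (0 : ℝ)) (b := R)).prod
    (isCompact_Icc (a := (0 : ℝ)) (b := R))).exists_bound_of_continuousOn hm.continuousOn
  have hint : Integrable (Function.uncurry f) (ρ.prod ρ) := by
    have h1 : Integrable (fun p : ℝ × ℝ => m p.1 p.2 • w p.2) (ρ.prod ρ) := by
      have h2 : Integrable (fun p : ℝ × ℝ => (C : ℝ) • w p.2) (ρ.prod ρ) :=
        Integrable.smul_prod (f := fun _ : ℝ => C) (by simp [ρ]) hw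
      refine h2.norm.mono' ?_ ?_
      · exact hm.aestronglyMeasurable.smul hw.aestronglyMeasurable.comp_snd
      · have : ∀ᵐ p ∂ρ.prod ρ, p ∈ (Ioc 0 R) ×ˢ (Ioc 0 R) := by
          rw [hρ, Measure.prod_restrict]
          exact ae_restrict_mem (measurableSet_Ioc.prod measurableSet_Ioc)
        filter_upwards [this] with p hp
        rw [norm_smul, norm_smul]
        gcongr
        exact (hC p ⟨Ioc_subset_Icc_self hp.1, Ioc_subset_Icc_self hp.2⟩).trans (le_abs_self C)
    exact h1.indicator hDm
  rw [intervalIntegral.integral_of_le hR, intervalIntegral.integral_of_le hR]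
  have hl : ∀ z ∈ Ioc 0 R, ∫ y in (0 : ℝ)..z, m z y • w y = ∫ y, f z y ∂ρ := by
    intro z hz
    rw [intervalIntegral.integral_of_le hz.1.le]
    have : f z = (Iic z).indicator fun y => m z y • w y := by
      ext y; simp [f, D, indicator]
    rw [this, hρ, integral_indicator measurableSet_Iic, Measure.restrict_restrict measurableSet_Iic]
    congr 2
    ext y; simp only [mem_Ioc, mem_inter_iff, mem_Iic]
    exact ⟨fun h => ⟨h.2, h.1, h.2.trans hz.2⟩, fun h => ⟨h.2.1, h.1⟩⟩
  have hr : ∀ y ∈ Ioc 0 R, (∫ z in y..R, m z y) • w y = ∫ z, f z y ∂ρ := by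
    intro y hy
    rw [intervalIntegral.integral_of_le hy.2, ← integral_smul_const]
    have : (fun z => f z y) = (Ici y).indicator fun z => m z y • w y := by
      ext z; simp [f, D, indicator]
    rw [this, hρ, integral_indicator measurableSet_Ici, Measure.restrict_restrict measurableSet_Ici,
      ← integral_Icc_eq_integral_Ioc]
    congr 2
    ext z; simp only [mem_Icc, mem_inter_iff, mem_Ici, mem_Ioc]
    exact ⟨fun h => ⟨h.1, hy.1.trans_le h.1, h.2⟩, fun h => ⟨h.1, h.2.2⟩⟩
  rw [setIntegral_congr_fun measurableSet_Ioc hl, setIntegral_congr_fun measurableSet_Ioc hr]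
  exact integral_integral_swap hint

/-- Integrability on `(0, T)` for every `T`. -/
def LocInt (F : ℝ → E) : Prop := ∀ T : ℝ, 0 < T → IntegrableOn F (Ioo 0 T)

theorem LocInt.integrableOn_Ioc {F : ℝ → E} (hF : LocInt F) (T : ℝ) :
    IntegrableOn F (Ioc 0 T) := by
  rcases le_or_gt T 0 with h | h
  · simp [Ioc_eq_empty_of_le h]
  · exact (integrableOn_Ioc_iff_integrableOn_Ioo).2 (hF T h)

theorem LocInt.intervalIntegrable {F : ℝ → E} (hF : LocInt F) {T : ℝ} (hT : 0 ≤ T) :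
    IntervalIntegrable F volume 0 T :=
  (intervalIntegrable_iff_integrableOn_Ioc_of_le hT).2 (hF.integrableOn_Ioc T)

theorem LocInt.congr {F G : ℝ → E} (hF : LocInt F)
    (h : F =ᵐ[volume.restrict (Ioi (0 : ℝ))] G) : LocInt G := fun T hT =>
  (hF T hT).congr_fun_ae (ae_restrict_of_ae_restrict_of_subset Ioo_subset_Ioi_self h)

theorem locInt_of_continuousOn {F : ℝ → E} (hF : ContinuousOn F (Ici 0)) : LocInt F :=
  fun T _ => ((hF.mono Icc_subset_Ici_self).integrableOn_compact isCompact_Icc).mono_set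
    (Ioo_subset_Icc_self (b := T))

theorem LocInt.sub {F G : ℝ → E} (hF : LocInt F) (hG : LocInt G) :
    LocInt (fun t => F t - G t) := fun T hT => (hF T hT).sub (hG T hT)

theorem LocInt.clm {E' : Type*} [NormedAddCommGroup E'] [NormedSpace ℝ E'] {F : ℝ → E}
    (hF : LocInt F) (S : E →L[ℝ] E') : LocInt (fun t => S (F t)) :=
  fun T hT => S.integrable_comp (hF T hT)

theorem LocInt.clm_apply {E' : Type*} [NormedAddCommGroup E'] [NormedSpace ℝ E'] {F : ℝ → E}
    (hF : LocInt F) {S : ℝ → E →L[ℝ] E'} (hS : Continuous S) : LocInt (fun t => S t (F t)) := by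
  intro T hT
  obtain ⟨C, hC⟩ := (isCompact_Icc (a := (0 : ℝ)) (b := T)).exists_bound_of_continuousOn
    hS.continuousOn
  refine (((hF T hT).norm).const_mul C).mono' ?_ ?_
  · exact (ContinuousLinearMap.id ℝ (E →L[ℝ] E')).aestronglyMeasurable_comp₂
      hS.aestronglyMeasurable (hF T hT).aestronglyMeasurable
  · filter_upwards [ae_restrict_mem measurableSet_Ioo] with t ht
    exact (S t).le_of_opNorm_le (hC t (Ioo_subset_Icc_self ht)) _

theorem LocInt.locallyIntegrableOn {F : ℝ → E} (hF : LocInt F) :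
    LocallyIntegrableOn F (Ioi 0) := by
  rw [locallyIntegrableOn_iff isOpen_Ioi.isLocallyClosed]
  intro K hK hKc
  obtain ⟨T, hT⟩ := hKc.bddAbove
  refine (hF.integrableOn_Ioc T).mono_set fun x hx => ⟨hK hx, hT hx⟩

theorem LocInt.continuousOn_primitive {F : ℝ → E} (hF : LocInt F) :
    ContinuousOn (fun t => ∫ s in (0 : ℝ)..t, F s) (Ici 0) := by
  intro t ht
  have ht' : (0 : ℝ) ≤ t := ht
  have h1 : ContinuousOn (fun t => ∫ s in (0 : ℝ)..t, F s) (uIcc 0 (t + 1)) := by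
    apply intervalIntegral.continuousOn_primitive_interval
    rw [uIcc_of_le (by linarith)]
    exact (integrableOn_Icc_iff_integrableOn_Ioc).2 (hF.integrableOn_Ioc _)
  rw [uIcc_of_le (by linarith)] at h1
  refine (h1 t ⟨ht, by linarith⟩).mono_of_mem_nhdsWithin ?_
  rw [← Ici_inter_Iic]
  exact inter_mem self_mem_nhdsWithin (mem_nhdsWithin_of_mem_nhds (Iic_mem_nhds (by linarith)))

theorem integral_congr_ae_Ioi {F G : ℝ → E}
    (h : F =ᵐ[volume.restrict (Ioi (0 : ℝ))] G) {t : ℝ} (ht : 0 ≤ t) :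
    ∫ s in (0 : ℝ)..t, F s = ∫ s in (0 : ℝ)..t, G s := by
  rw [intervalIntegral.integral_of_le ht, intervalIntegral.integral_of_le ht]
  exact integral_congr_ae (ae_restrict_of_ae_restrict_of_subset Ioc_subset_Ioi_self h)

theorem exists_tsupport_subset_Iic {φ : ℝ → ℝ} (hc : HasCompactSupport φ) :
    ∃ R : ℝ, 0 < R ∧ ∀ t, R ≤ t → φ t = 0 := by
  obtain ⟨R, hR⟩ := hc.isCompact.bddAbove
  refine ⟨max R 0 + 1, by positivity, fun t ht => ?_⟩
  apply image_eq_zero_of_notMem_tsupport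
  intro h
  have := hR h
  have := le_max_left R 0
  linarith

theorem integral_Ioi_eq_of_zero {F : ℝ → E} {R : ℝ} (hR : 0 ≤ R) (h : ∀ t, R ≤ t → F t = 0) :
    ∫ t in Ioi (0 : ℝ), F t = ∫ t in (0 : ℝ)..R, F t := by
  rw [intervalIntegral.integral_of_le hR]
  refine setIntegral_eq_of_subset_of_forall_sdiff_eq_zero measurableSet_Ioi Ioc_subset_Ioi_self ?_
  intro x hx
  apply h
  by_contra hlt
  exact hx.2 ⟨hx.1, (not_le.1 hlt).le⟩

/-- Integration by parts, obtained from Fubini on the triangle since `φ'` integrates to `-φ y` from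
`y` on. The test function need not vanish at `0`: the term `φ 0 • c` is what later reads off
boundary values. -/
theorem integral_deriv_smul_primitive {F : ℝ → E} (hF : LocInt F) (c : E) {φ : ℝ → ℝ}
    (hφ : ContDiff ℝ ∞ φ) (hc : HasCompactSupport φ) :
    ∫ t in Ioi (0 : ℝ), deriv φ t • (c + ∫ s in (0 : ℝ)..t, F s)
      = -(φ 0 • c) - ∫ t in Ioi (0 : ℝ), φ t • F t := by
  obtain ⟨R, hR, h1⟩ := exists_tsupport_subset_Iic hc
  obtain ⟨R', hR', h2⟩ := exists_tsupport_subset_Iic hc.deriv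
  set S := max R R' with hS
  have hS0 : 0 ≤ S := hR.le.trans (le_max_left _ _)
  have hd : Continuous (deriv φ) := hφ.continuous_deriv (by simp)
  have hftc : ∀ y, ∫ z in y..S, deriv φ z = - φ y := by
    intro y
    rw [intervalIntegral.integral_deriv_eq_sub (fun x _ => (hφ.differentiable (by simp)) x)
      (hd.intervalIntegrable _ _), h1 S (le_max_left _ _), zero_sub]
  rw [integral_Ioi_eq_of_zero hS0 (fun t ht => by rw [h2 t ((le_max_right _ _).trans ht), zero_smul]),
    integral_Ioi_eq_of_zero hS0 (fun t ht => by rw [h1 t ((le_max_left _ _).trans ht), zero_smul])]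
  simp only [smul_add]
  have hi : IntervalIntegrable (fun t => deriv φ t • ∫ s in (0 : ℝ)..t, F s) volume 0 S := by
    apply ContinuousOn.intervalIntegrable
    rw [uIcc_of_le hS0]
    exact hd.continuousOn.smul (hF.continuousOn_primitive.mono Icc_subset_Ici_self)
  have hi' : IntervalIntegrable (fun t => deriv φ t • c) volume 0 S :=
    (hd.smul continuous_const).intervalIntegrable _ _
  rw [intervalIntegral.integral_add hi' hi,
    intervalIntegral.integral_smul_const, hftc, neg_smul, sub_eq_add_neg]
  congr 1
  have := integral_triangle_swap (m := fun z _ => deriv φ z) (w := F) (by fun_prop) hS0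
    (hF.integrableOn_Ioc S)
  simp only [intervalIntegral.integral_smul] at this
  rw [this]
  simp only [hftc, neg_smul, intervalIntegral.integral_neg]

/-- The zero mean makes the primitive from `0` vanish again beyond the support of `θ`. -/
theorem exists_smooth_primitive {θ : ℝ → ℝ} (hθ : ContDiff ℝ ∞ θ) (hc : HasCompactSupport θ)
    (hs : tsupport θ ⊆ Ioi 0) (h0 : ∫ t in Ioi (0 : ℝ), θ t = 0) :
    ∃ η : ℝ → ℝ, ContDiff ℝ ∞ η ∧ HasCompactSupport η ∧ tsupport η ⊆ Ioi 0 ∧ deriv η = θ := by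
  obtain ⟨R, hR, h1⟩ := exists_tsupport_subset_Iic hc
  -- A compact support inside the open half-line stays away from `0`.
  obtain ⟨ε, hε, h2⟩ : ∃ ε : ℝ, 0 < ε ∧ ∀ t, t ≤ ε → θ t = 0 := by
    rcases (tsupport θ).eq_empty_or_nonempty with he | hne
    · exact ⟨1, one_pos, fun t _ => image_eq_zero_of_notMem_tsupport (by simp [he])⟩
    · obtain ⟨x, hx, hmin⟩ := hc.isCompact.exists_isLeast hne
      have hx0 : 0 < x := hs hx
      refine ⟨x / 2, by positivity, fun t ht => image_eq_zero_of_notMem_tsupport fun h => ?_⟩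
      have := hmin h
      linarith
  set η : ℝ → ℝ := fun t => ∫ s in (0 : ℝ)..t, θ s with hη
  have hd : ∀ t, HasDerivAt η (θ t) t := fun t =>
    (hθ.continuous.integral_hasStrictDerivAt 0 t).hasDerivAt
  have hde : deriv η = θ := funext fun t => (hd t).deriv
  have hsupp : Function.support η ⊆ Icc ε R := by
    intro t ht
    by_contra hn
    apply ht
    rw [mem_Icc, not_and_or, not_le, not_le] at hn
    rcases hn with hn | hn
    · have : ∫ s in (0 : ℝ)..t, θ s = ∫ s in (0 : ℝ)..t, (0 : ℝ) := by
        apply intervalIntegral.integral_congr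
        intro s hs
        exact h2 s (hs.2.trans (max_le hε.le hn.le))
      simp [hη, this]
    · have : ∫ t in Ioi (0 : ℝ), θ t = ∫ s in (0 : ℝ)..t, θ s :=
        integral_Ioi_eq_of_zero (hR.le.trans hn.le) fun s hs => h1 s (hn.le.trans hs)
      rw [hη]; simp only; rw [← this, h0]
  have hts : tsupport η ⊆ Icc ε R := closure_minimal hsupp isClosed_Icc
  refine ⟨η, ?_, ?_, hts.trans fun t ht => hε.trans_le ht.1, hde⟩
  · rw [contDiff_infty_iff_deriv, hde]
    exact ⟨fun t => (hd t).differentiableAt, hθ⟩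
  · exact HasCompactSupport.of_support_subset_isCompact isCompact_Icc hsupp

theorem smul_test_integrable {F : ℝ → E} (hF : LocInt F) {φ : ℝ → ℝ}
    (hφ : Continuous φ) (hc : HasCompactSupport φ) :
    IntegrableOn (fun t => φ t • F t) (Ioi 0) := by
  obtain ⟨R, hR, h1⟩ := exists_tsupport_subset_Iic hc
  have h2 : LocInt (fun t => φ t • F t) := by
    have := hF.clm_apply (S := fun t => φ t • ContinuousLinearMap.id ℝ E) (by fun_prop)
    simpa using this
  refine (h2.integrableOn_Ioc R).of_forall_sdiff_eq_zero measurableSet_Ioi fun x hx => ?_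
  rw [h1, zero_smul]
  by_contra hlt
  exact hx.2 ⟨hx.1, (not_le.1 hlt).le⟩

/-- The lemma of du Bois-Reymond on `(0, ∞)`. -/
theorem ae_eq_const_of_weakDeriv_zero {G : ℝ → E} (hG : LocInt G)
    (h : ∀ φ : ℝ → ℝ, ContDiff ℝ ∞ φ → HasCompactSupport φ → tsupport φ ⊆ Ioi 0 →
      ∫ t in Ioi (0 : ℝ), deriv φ t • G t = 0) :
    ∃ c : E, G =ᵐ[volume.restrict (Ioi (0 : ℝ))] fun _ => c := by
  -- A fixed test function of integral `1`, supported in `[1, 3]`; the constant will be its pairing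
  -- with `G`.
  let b : ContDiffBump (2 : ℝ) := ⟨1 / 2, 1, by norm_num, by norm_num⟩
  set ψ := b.normed volume with hψ
  have hψs : ContDiff ℝ ∞ ψ := b.contDiff_normed
  have hψc : HasCompactSupport ψ := b.hasCompactSupport_normed
  have hψt : tsupport ψ ⊆ Ioi 0 := by
    rw [hψ, b.tsupport_normed_eq]
    intro x hx
    have : |x - 2| ≤ 1 := hx
    have := (abs_le.1 this).1
    show 0 < x
    linarith
  have hψ1 : ∫ t in Ioi (0 : ℝ), ψ t = 1 := by
    rw [setIntegral_eq_integral_of_forall_compl_eq_zero, hψ, b.integral_normed]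
    intro x hx
    exact image_eq_zero_of_notMem_tsupport fun h => hx (hψt h)
  set c := ∫ t in Ioi (0 : ℝ), ψ t • G t with hcdef
  refine ⟨c, ?_⟩
  have hGc : LocInt (fun t => G t - c) := hG.sub (locInt_of_continuousOn continuousOn_const)
  have key := isOpen_Ioi.ae_eq_zero_of_integral_contDiff_smul_eq_zero (μ := volume)
    hGc.locallyIntegrableOn ?_
  · rw [EventuallyEq, ae_restrict_iff' measurableSet_Ioi]
    filter_upwards [key] with t ht hts
    exact sub_eq_zero.1 (ht hts)
  intro φ hφ hc hs
  have e1 : ∫ t, φ t • (G t - c) = ∫ t in Ioi (0 : ℝ), φ t • (G t - c) := by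
    rw [setIntegral_eq_integral_of_forall_compl_eq_zero]
    intro x hx
    rw [image_eq_zero_of_notMem_tsupport fun h => hx (hs h), zero_smul]
  have hφi : IntegrableOn φ (Ioi 0) := (hφ.continuous.integrable_of_hasCompactSupport hc).integrableOn
  have hψi : IntegrableOn ψ (Ioi 0) :=
    (hψs.continuous.integrable_of_hasCompactSupport hψc).integrableOn
  set d := ∫ t in Ioi (0 : ℝ), φ t with hd
  -- Subtracting `d • ψ` from `φ` gives zero mean, hence a derivative of a test function, to which
  -- `h` applies.
  obtain ⟨η, hη1, hη2, hη3, hη4⟩ := exists_smooth_primitive (θ := fun t => φ t - d * ψ t)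
    (hφ.sub (contDiff_const.mul hψs)) (hc.sub (hψc.mul_left))
    ((tsupport_sub _ _).trans (union_subset hs
      ((tsupport_mul_subset_right (f := fun _ => d)).trans hψt)))
    (by rw [integral_sub hφi (hψi.const_mul d), integral_const_mul, hψ1, ← hd]; ring)
  have h3 := h η hη1 hη2 hη3
  rw [hη4] at h3
  have i1 := smul_test_integrable hG hφ.continuous hc
  have i2 := smul_test_integrable hG hψs.continuous hψc
  have i3 : IntegrableOn (fun t => d • ψ t • G t) (Ioi 0) := i2.smul d
  simp only [sub_smul, mul_smul] at h3
  rw [integral_sub i1 i3, integral_smul, ← hcdef] at h3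
  rw [e1]
  simp only [smul_sub]
  rw [integral_sub i1 (hφi.smul_const c), integral_smul_const, ← hd, h3]

/-- `F` minus the primitive of `F'` has zero weak derivative. This serves both in time and, with `E
= ℝ`, in space. -/
theorem exists_eq_primitive {F F' : ℝ → E} (hF : LocInt F) (hF' : LocInt F')
    (h : HasWeakTimeDeriv F F') :
    ∃ c : E, F =ᵐ[volume.restrict (Ioi (0 : ℝ))] fun t => c + ∫ s in (0 : ℝ)..t, F' s := by
  have hP : LocInt (fun t => ∫ s in (0 : ℝ)..t, F' s) :=
    locInt_of_continuousOn hF'.continuousOn_primitive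
  obtain ⟨c, hc⟩ := ae_eq_const_of_weakDeriv_zero (hF.sub hP) fun φ hφ hc hs => by
    have h1 := integral_deriv_smul_primitive hF' 0 hφ hc
    simp only [zero_add, smul_zero, neg_zero, zero_sub] at h1
    simp only [smul_sub]
    have hd : Continuous (deriv φ) := hφ.continuous_deriv (by simp)
    rw [integral_sub (smul_test_integrable hF hd hc.deriv) (smul_test_integrable hP hd hc.deriv),
      h1, h φ hφ hc hs, sub_self]
  refine ⟨c, ?_⟩
  filter_upwards [hc] with t ht
  rw [← ht]; abel

theorem contDiffOn_succ_of_hasDerivWithinAt {U U' : ℝ → E} {j : ℕ}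
    (h : ∀ t, 0 ≤ t → HasDerivWithinAt U (U' t) (Ici 0) t)
    (h' : ContDiffOn ℝ j U' (Ici 0)) : ContDiffOn ℝ (j + 1 : ℕ) U (Ici 0) := by
  push_cast
  rw [contDiffOn_succ_iff_derivWithin (uniqueDiffOn_Ici 0)]
  refine ⟨fun t ht => (h t ht).differentiableWithinAt, by simp, h'.congr fun t ht => ?_⟩
  exact (h t ht).derivWithin (uniqueDiffOn_Ici 0 t ht)

theorem hasDerivWithinAt_primitive {G : ℝ → E} (hG : ContinuousOn G (Ici 0)) {t : ℝ} (ht : 0 ≤ t) :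
    HasDerivWithinAt (fun t => ∫ s in (0 : ℝ)..t, G s) (G t) (Ici 0) t := by
  -- Freezing `G` at its value at `0` gives a continuous function on the line, so the two-sided
  -- fundamental theorem also covers `t = 0`.
  have hc : Continuous fun s => G (max s 0) :=
    hG.comp_continuous (by fun_prop) fun s => le_max_right s 0
  have h1 := ((hc.integral_hasStrictDerivAt 0 t).hasDerivAt).hasDerivWithinAt (s := Ici 0)
  simp only [max_eq_left ht] at h1
  have e : ∀ t, 0 ≤ t → ∫ s in (0 : ℝ)..t, G s = ∫ s in (0 : ℝ)..t, G (max s 0) := by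
    intro t ht
    apply intervalIntegral.integral_congr
    intro s hs
    rw [uIcc_of_le ht] at hs
    simp [max_eq_left hs.1]
  exact h1.congr (fun t ht => e t ht) (e t ht)

/-- Each weak derivative is almost everywhere a primitive of the next, so all but the last have
continuous representatives: one order of differentiability is lost. -/
theorem memW1loc_exists_contDiffOn {j : ℕ} {F : ℝ → E} (hF : MemW1loc (j + 1) F) :
    ∃ G : ℝ → E, ContDiffOn ℝ j G (Ici 0) ∧ F =ᵐ[volume.restrict (Ioi (0 : ℝ))] G := by
  induction j generalizing F with
  | zero =>
    obtain ⟨D, rfl, hi, hd⟩ := hF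
    obtain ⟨c, hc⟩ := exists_eq_primitive (hi 0 (by simp)) (hi 1 le_rfl) (hd 0 (by simp))
    refine ⟨_, ?_, hc⟩
    simp only [Nat.cast_zero, contDiffOn_zero]
    exact continuousOn_const.add (LocInt.continuousOn_primitive (hi 1 le_rfl))
  | succ j ih =>
    obtain ⟨D, rfl, hi, hd⟩ := hF
    obtain ⟨c, hc⟩ := exists_eq_primitive (hi 0 (by simp)) (hi 1 (by omega)) (hd 0 (by simp))
    obtain ⟨G, hG, hDG⟩ := ih (F := D 1)
      ⟨fun i => D (i + 1), rfl, fun i h => hi (i + 1) (by omega), fun i h => hd (i + 1) (by omega)⟩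
    refine ⟨fun t => c + ∫ s in (0 : ℝ)..t, G s, ?_, ?_⟩
    · exact contDiffOn_succ_of_hasDerivWithinAt
        (fun t ht => (hasDerivWithinAt_primitive hG.continuousOn ht).const_add c) hG
    · filter_upwards [hc, ae_restrict_mem measurableSet_Ioi] with t ht h0
      rw [ht, integral_congr_ae_Ioi hDG (le_of_lt h0)]

/-! ## Duhamel's formula -/

/-- The mild solution of `u' = F - A u`, `u(0) = u₀`, for a bounded operator `A`. -/
noncomputable def duhamel (A : E →L[ℝ] E) (F : ℝ → E) (u₀ : E) (t : ℝ) : E :=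
  NormedSpace.exp (-t • A) (u₀ + ∫ s in (0 : ℝ)..t, NormedSpace.exp (s • A) (F s))

theorem hasDerivAt_exp_smul (A : E →L[ℝ] E) (t : ℝ) :
    HasDerivAt (fun t : ℝ => NormedSpace.exp (t • A)) (A * NormedSpace.exp (t • A)) t :=
  hasDerivAt_exp_smul_const' A t

theorem hasDerivAt_exp_neg_smul (A : E →L[ℝ] E) (t : ℝ) :
    HasDerivAt (fun t : ℝ => NormedSpace.exp (-t • A)) (-(A * NormedSpace.exp (-t • A))) t := by
  have := (hasDerivAt_exp_smul A (-t)).scomp t (hasDerivAt_neg t)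
  simpa [Function.comp_def] using this

theorem continuous_exp_smul (A : E →L[ℝ] E) :
    Continuous (fun t : ℝ => NormedSpace.exp (t • A)) :=
  continuous_iff_continuousAt.2 fun t => (hasDerivAt_exp_smul A t).continuousAt

theorem exp_neg_mul_exp (A : E →L[ℝ] E) (t : ℝ) :
    NormedSpace.exp (-t • A) * NormedSpace.exp (t • A) = 1 := by
  have hc : Commute (-t • A) (t • A) := ((Commute.refl A).smul_left _).smul_right _
  rw [← NormedSpace.exp_add_of_commute_of_mem_ball (𝕂 := ℝ) hc
    (by rw [NormedSpace.expSeries_radius_eq_top]; simp)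
    (by rw [NormedSpace.expSeries_radius_eq_top]; simp)]
  simp

theorem exp_apply_hasSum (A : E →L[ℝ] E) (v : E) :
    HasSum (fun n : ℕ => ((n.factorial : ℝ)⁻¹) • (A ^ n) v) (NormedSpace.exp A v) := by
  have h := NormedSpace.exp_series_hasSum_exp' (𝕂 := ℝ) A
  simpa using h.mapL (ContinuousLinearMap.apply ℝ E v)

theorem exp_intertwine {E' : Type*} [NormedAddCommGroup E'] [NormedSpace ℝ E'] [CompleteSpace E']
    {A : E →L[ℝ] E} {A' : E' →L[ℝ] E'} {S : E →L[ℝ] E'} (h : ∀ v, S (A v) = A' (S v)) (v : E) :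
    S (NormedSpace.exp A v) = NormedSpace.exp A' (S v) := by
  have hp : ∀ n : ℕ, S ((A ^ n) v) = (A' ^ n) (S v) := by
    intro n
    induction n with
    | zero => simp
    | succ n ih => rw [pow_succ', pow_succ', mul_apply_eq_comp,
        mul_apply_eq_comp, h, ih]
  have h1 := (exp_apply_hasSum A v).mapL S
  simp only [map_smul, hp] at h1
  exact h1.unique (exp_apply_hasSum A' (S v))

/-- Used with `S` the inclusion of `H^k_a` in `L²_a`, and with `S` the trace at `x = 0`. -/
theorem duhamel_intertwine {E' : Type*} [NormedAddCommGroup E'] [NormedSpace ℝ E']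
    [CompleteSpace E'] {A : E →L[ℝ] E} {A' : E' →L[ℝ] E'} {S : E →L[ℝ] E'}
    (h : ∀ v, S (A v) = A' (S v)) {F : ℝ → E} (hF : LocInt F) (u₀ : E) {t : ℝ} (ht : 0 ≤ t) :
    S (duhamel A F u₀ t) = duhamel A' (fun s => S (F s)) (S u₀) t := by
  have hs : ∀ s : ℝ, ∀ v, S ((s • A) v) = (s • A') (S v) := fun s v => by simp [h]
  unfold duhamel
  rw [exp_intertwine (hs _), map_add, ← ContinuousLinearMap.intervalIntegral_comp_comm]
  · simp only [exp_intertwine (hs _)]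
  · exact (hF.clm_apply (continuous_exp_smul A)).intervalIntegrable ht

theorem duhamel_congr (A : E →L[ℝ] E) {F G : ℝ → E}
    (h : F =ᵐ[volume.restrict (Ioi (0 : ℝ))] G) (u₀ : E) {t : ℝ} (ht : 0 ≤ t) :
    duhamel A F u₀ t = duhamel A G u₀ t := by
  unfold duhamel
  rw [integral_congr_ae_Ioi _ ht]
  filter_upwards [h] with s hs
  rw [hs]

theorem duhamel_zero (A : E →L[ℝ] E) (F : ℝ → E) (u₀ : E) : duhamel A F u₀ 0 = u₀ := by
  simp [duhamel]

theorem continuousOn_duhamel (A : E →L[ℝ] E) {F : ℝ → E} (hF : LocInt F) (u₀ : E) :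
    ContinuousOn (duhamel A F u₀) (Ici 0) := by
  have h1 : Continuous (fun t : ℝ => NormedSpace.exp (-t • A)) :=
    (continuous_exp_smul A).comp continuous_neg
  exact h1.continuousOn.clm_apply
    (continuousOn_const.add (hF.clm_apply (continuous_exp_smul A)).continuousOn_primitive)

theorem hasDerivWithinAt_duhamel (A : E →L[ℝ] E) {F : ℝ → E} (hF : ContinuousOn F (Ici 0))
    (u₀ : E) {t : ℝ} (ht : 0 ≤ t) :
    HasDerivWithinAt (duhamel A F u₀) (F t - A (duhamel A F u₀ t)) (Ici 0) t := by
  have h1 : ContinuousOn (fun s => NormedSpace.exp (s • A) (F s)) (Ici 0) :=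
    (continuous_exp_smul A).continuousOn.clm_apply hF
  have h2 := (hasDerivAt_exp_neg_smul A t).hasDerivWithinAt (s := Ici 0) |>.clm_apply
    ((hasDerivWithinAt_primitive h1 ht).const_add u₀)
  have h3 : NormedSpace.exp (-t • A) (NormedSpace.exp (t • A) (F t)) = F t := by
    rw [← mul_apply_eq_comp, exp_neg_mul_exp, one_apply_eq_self]
  rw [h3] at h2
  refine h2.congr_deriv ?_
  rw [sub_eq_neg_add, neg_apply, mul_apply_eq_comp]
  rfl

/-- Bootstrap: the derivative `F - A u` is as smooth as the worse of `F` and `u`, so `u` gains one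
order at a time up to `q + 1`. -/
theorem contDiffOn_duhamel (A : E →L[ℝ] E) {q : ℕ} {F : ℝ → E} (hF : ContDiffOn ℝ q F (Ici 0))
    (u₀ : E) : ContDiffOn ℝ (q + 1 : ℕ) (duhamel A F u₀) (Ici 0) := by
  have key : ∀ m : ℕ, m ≤ q + 1 → ContDiffOn ℝ m (duhamel A F u₀) (Ici 0) := by
    intro m
    induction m with
    | zero =>
      intro _
      simp only [Nat.cast_zero, contDiffOn_zero]
      exact continuousOn_duhamel A (locInt_of_continuousOn hF.continuousOn) u₀
    | succ m ih =>
      intro hm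
      refine contDiffOn_succ_of_hasDerivWithinAt
        (fun t ht => hasDerivWithinAt_duhamel A hF.continuousOn u₀ ht) ?_
      exact (hF.of_le (by exact_mod_cast (by omega : m ≤ q))).sub
        (A.contDiff.comp_contDiffOn (ih (by omega)))
  exact key _ le_rfl

/-- `exp(tA) (u - v)` has zero derivative. Only the difference of the two equations is assumed, so
that a source known almost everywhere has already dropped out. -/
theorem eqOn_of_linear_ode {A : E →L[ℝ] E} {u v u' v' : ℝ → E}
    (hu : ∀ t, 0 ≤ t → HasDerivWithinAt u (u' t) (Ici 0) t)
    (hv : ∀ t, 0 ≤ t → HasDerivWithinAt v (v' t) (Ici 0) t) (h0 : u 0 = v 0)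
    (h : ∀ t, 0 ≤ t → u' t - v' t = -A (u t - v t)) {t : ℝ} (ht : 0 ≤ t) : u t = v t := by
  set w : ℝ → E := fun t => NormedSpace.exp (t • A) (u t - v t) with hw
  have hd : ∀ t, 0 ≤ t → HasDerivWithinAt w 0 (Ici 0) t := by
    intro t ht
    have h2 := (hasDerivAt_exp_smul_const A t).hasDerivWithinAt (s := Ici 0) |>.clm_apply
      ((hu t ht).sub (hv t ht))
    refine h2.congr_deriv ?_
    rw [h t ht]
    simp
  have hconst := constant_of_has_deriv_right_zero (f := w) (a := 0) (b := t)
    (fun s hs => ((hd s hs.1).continuousWithinAt).mono Icc_subset_Ici_self)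
    (fun s hs => (hd s hs.1).mono (Ici_subset_Ici.2 hs.1)) t ⟨ht, le_rfl⟩
  have hz : w t = 0 := by rw [hconst]; simp [hw, h0]
  have h3 : NormedSpace.exp (-t • A) (w t) = u t - v t := by
    rw [hw, ← mul_apply_eq_comp, exp_neg_mul_exp, one_apply_eq_self]
  rw [hz, map_zero] at h3
  exact (sub_eq_zero.1 h3.symm)

end Time

/-! ## The derivatives of the kernel -/

/-- The `m`-th derivative of the Bessel function `J₀`. -/
noncomputable def besselDeriv (m : ℕ) (x : ℝ) : ℝ :=
  (1 / Real.pi) * ∫ θ in (0 : ℝ)..Real.pi,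
    Real.sin θ ^ m * Real.cos (x * Real.sin θ + m * (Real.pi / 2))

theorem besselDeriv_zero (x : ℝ) : besselDeriv 0 x = besselJ 0 x := by
  simp [besselDeriv, besselJ]

theorem abs_besselDeriv_le (m : ℕ) (x : ℝ) : |besselDeriv m x| ≤ 1 := by
  have h : ‖∫ θ in (0 : ℝ)..Real.pi,
      Real.sin θ ^ m * Real.cos (x * Real.sin θ + m * (Real.pi / 2))‖ ≤ 1 * |Real.pi - 0| := by
    refine intervalIntegral.norm_integral_le_of_norm_le_const fun θ _ => ?_
    rw [norm_mul, norm_pow]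
    exact mul_le_one₀ (pow_le_one₀ (norm_nonneg _) (Real.abs_sin_le_one θ)) (norm_nonneg _)
      (Real.abs_cos_le_one _)
  rw [one_mul, sub_zero, abs_of_pos Real.pi_pos, Real.norm_eq_abs] at h
  rw [besselDeriv, abs_mul, abs_of_pos (by positivity), one_div, inv_mul_le_iff₀ Real.pi_pos,
    mul_one]
  exact h

/-- Under the integral, a derivative brings a factor `sin θ` and shifts the phase by `π/2`. The
integrand stays bounded by `1`, which provides the domination. -/
theorem hasDerivAt_besselDeriv (m : ℕ) (x : ℝ) :
    HasDerivAt (besselDeriv m) (besselDeriv (m + 1) x) x := by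
  have h := (intervalIntegral.hasDerivAt_integral_of_dominated_loc_of_deriv_le (μ := volume)
    (a := 0) (b := Real.pi) (bound := fun _ => 1) (x₀ := x) (s := univ)
    (F := fun x θ => Real.sin θ ^ m * Real.cos (x * Real.sin θ + m * (Real.pi / 2)))
    (F' := fun x θ => Real.sin θ ^ (m + 1) *
      Real.cos (x * Real.sin θ + (m + 1 : ℕ) * (Real.pi / 2))) univ_mem
    (Eventually.of_forall fun y => Continuous.aestronglyMeasurable (by fun_prop))
    (Continuous.intervalIntegrable (by fun_prop) _ _)
    (Continuous.aestronglyMeasurable (by fun_prop))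
    (Eventually.of_forall fun θ _ y _ => ?_)
    (by simp) (Eventually.of_forall fun θ _ y _ => ?_)).2
  · exact h.const_mul (1 / Real.pi)
  · rw [norm_mul, norm_pow]
    exact mul_le_one₀ (pow_le_one₀ (norm_nonneg _) (Real.abs_sin_le_one θ)) (norm_nonneg _)
      (Real.abs_cos_le_one _)
  · have h1 : HasDerivAt (fun y => y * Real.sin θ + m * (Real.pi / 2)) (Real.sin θ) y := by
      simpa using ((hasDerivAt_id y).mul_const (Real.sin θ)).add_const (m * (Real.pi / 2))
    refine (h1.cos.const_mul (Real.sin θ ^ m)).congr_deriv ?_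
    have : Real.cos (y * Real.sin θ + (m + 1 : ℕ) * (Real.pi / 2))
        = -Real.sin (y * Real.sin θ + m * (Real.pi / 2)) := by
      rw [← Real.cos_add_pi_div_two]
      congr 1
      push_cast
      ring
    rw [this, pow_succ]
    ring

theorem besselDeriv_zero_zero : besselDeriv 0 0 = 1 := by
  simp [besselDeriv, Real.pi_ne_zero]

theorem kappa_pos {μ : ℝ} (hμ : 0 < μ) : 0 < kappa μ := Real.sqrt_pos.2 (by positivity)

/-- The `m`-th derivative of the kernel `𝒦⁰_μ`. -/
noncomputable def kernelDeriv (μ : ℝ) (m : ℕ) (x : ℝ) : ℝ :=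
  (kappa μ)⁻¹ ^ (m + 1) * besselDeriv m (x / kappa μ)

theorem kernelDeriv_zero (μ : ℝ) : kernelDeriv μ 0 = kernelK0 μ := by
  ext x
  simp [kernelDeriv, kernelK0, besselDeriv_zero]

theorem kernelDeriv_zero_zero (μ : ℝ) : kernelDeriv μ 0 0 = (kappa μ)⁻¹ := by
  simp [kernelDeriv, besselDeriv_zero_zero]

theorem hasDerivAt_kernelDeriv (μ : ℝ) (m : ℕ) (x : ℝ) :
    HasDerivAt (kernelDeriv μ m) (kernelDeriv μ (m + 1) x) x := by
  have h := ((hasDerivAt_besselDeriv m (x / kappa μ)).comp x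
    ((hasDerivAt_id x).div_const (kappa μ))).const_mul ((kappa μ)⁻¹ ^ (m + 1))
  refine h.congr_deriv ?_
  rw [kernelDeriv, pow_succ _ (m + 1)]
  ring

theorem continuous_kernelDeriv (μ : ℝ) (m : ℕ) : Continuous (kernelDeriv μ m) :=
  continuous_iff_continuousAt.2 fun x => (hasDerivAt_kernelDeriv μ m x).continuousAt

theorem abs_kernelDeriv_le {μ : ℝ} (hμ : 0 < μ) (m : ℕ) (x : ℝ) :
    |kernelDeriv μ m x| ≤ (kappa μ)⁻¹ ^ (m + 1) := by
  have := kappa_pos hμ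
  rw [kernelDeriv, abs_mul, abs_of_pos (by positivity)]
  exact mul_le_of_le_one_right (by positivity) (abs_besselDeriv_le _ _)

theorem integral_kernelDeriv (μ : ℝ) (m : ℕ) (x y : ℝ) :
    ∫ z in x..y, kernelDeriv μ (m + 1) z = kernelDeriv μ m y - kernelDeriv μ m x :=
  intervalIntegral.integral_eq_sub_of_hasDerivAt (fun z _ => hasDerivAt_kernelDeriv μ m z)
    ((continuous_kernelDeriv μ (m + 1)).intervalIntegrable _ _)

/-! ## Causal convolution on `L²_a` -/

theorem isFiniteMeasure_weight {a : ℝ} (ha : 0 < a) : IsFiniteMeasure (weightMeasure a) := by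
  have h : Integrable (fun _ : ℝ => (1 : ℝ)) (weightMeasure a) := by
    rw [integrable_weight_iff]
    simp only [mul_one]
    exact integrableOn_exp_mul_Ioi (by linarith) 0
  exact (integrable_const_iff_isFiniteMeasure one_ne_zero).1 h

/-- For `a > 0` the weighted measure is finite, so `L²_a` functions are integrable for it; on `(0,
T)` the weight can be removed. Integrability thus reaches the boundary `x = 0`. -/
theorem locInt_L2 {a : ℝ} (ha : 0 < a) (v : L2 a) : LocInt (v : ℝ → ℝ) := by
  have := isFiniteMeasure_weight ha
  have h1 : Integrable (v : ℝ → ℝ) (weightMeasure a) := (Lp.memLp v).integrable (by norm_num)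
  rw [integrable_weight_iff] at h1
  have h2 : LocInt (fun x => Real.exp (-2 * a * x) * v x) :=
    fun T _ => h1.mono_set Ioo_subset_Ioi_self
  have h3 := h2.clm_apply (S := fun x => Real.exp (2 * a * x) • ContinuousLinearMap.id ℝ ℝ)
    (by fun_prop)
  refine h3.congr (Eventually.of_forall fun x => ?_)
  have : Real.exp (2 * a * x) * Real.exp (-2 * a * x) = 1 := by rw [← Real.exp_add]; simp
  simp only [smul_apply, ContinuousLinearMap.id_apply, smul_eq_mul]
  rw [← mul_assoc, this, one_mul]

theorem lintegral_exp_neg_Ici {a : ℝ} (ha : 0 < a) (y : ℝ) :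
    ∫⁻ x in Ici y, ENNReal.ofReal (Real.exp (-a * x)) = ENNReal.ofReal (Real.exp (-a * y) / a) := by
  rw [← restrict_Ioi_eq_restrict_Ici, ← ofReal_integral_eq_lintegral_ofReal
    (integrableOn_exp_mul_Ioi (by linarith) y) (Eventually.of_forall fun x => (Real.exp_pos _).le),
    integral_exp_mul_Ioi (by linarith)]
  congr 1
  rw [neg_div_neg_eq]

theorem lintegral_exp_Ioc_le {a : ℝ} (ha : 0 < a) {x : ℝ} (hx : 0 ≤ x) :
    ∫⁻ y in Ioc 0 x, ENNReal.ofReal (Real.exp (a * y)) ≤ ENNReal.ofReal (Real.exp (a * x) / a) := by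
  have hc : Continuous fun y : ℝ => Real.exp (a * y) := by fun_prop
  rw [← ofReal_integral_eq_lintegral_ofReal (hc.integrableOn_Ioc)
    (Eventually.of_forall fun x => (Real.exp_pos _).le), ← intervalIntegral.integral_of_le hx]
  apply ENNReal.ofReal_le_ofReal
  rw [intervalIntegral.integral_comp_mul_left (f := Real.exp) ha.ne', integral_exp, smul_eq_mul,
    div_eq_inv_mul]
  gcongr
  simp

/-- Cauchy–Schwarz for the splitting `g = e^{ay/2} · e^{-ay/2} g`. Half of the decay is kept for the
integration in `x` in the Hardy inequality. -/
theorem sq_lintegral_le {a : ℝ} (ha : 0 < a) {g : ℝ → ℝ≥0∞} (hg : Measurable g) {x : ℝ}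
    (hx : 0 ≤ x) :
    (∫⁻ y in Ioc 0 x, g y) ^ 2 ≤ ENNReal.ofReal (Real.exp (a * x) / a) *
      ∫⁻ y in Ioc 0 x, ENNReal.ofReal (Real.exp (-a * y)) * g y ^ 2 := by
  have h := ENNReal.lintegral_mul_le_Lp_mul_Lq (volume.restrict (Ioc 0 x))
    Real.HolderConjugate.two_two
    (f := fun y => ENNReal.ofReal (Real.exp (a / 2 * y)))
    (g := fun y => ENNReal.ofReal (Real.exp (-(a / 2) * y)) * g y)
    (by fun_prop) (by fun_prop)
  have e0 : ∀ y, ENNReal.ofReal (Real.exp (a / 2 * y)) *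
      (ENNReal.ofReal (Real.exp (-(a / 2) * y)) * g y) = g y := by
    intro y
    rw [← mul_assoc, ← ENNReal.ofReal_mul (Real.exp_pos _).le, ← Real.exp_add]
    simp
  have e1 : ∀ y, ENNReal.ofReal (Real.exp (a / 2 * y)) ^ (2 : ℝ)
      = ENNReal.ofReal (Real.exp (a * y)) := by
    intro y
    rw [ENNReal.rpow_two, ← ENNReal.ofReal_pow (Real.exp_pos _).le, ← Real.exp_nat_mul]
    congr 2
    push_cast
    ring
  have e2 : ∀ y, (ENNReal.ofReal (Real.exp (-(a / 2) * y)) * g y) ^ (2 : ℝ)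
      = ENNReal.ofReal (Real.exp (-a * y)) * g y ^ 2 := by
    intro y
    rw [ENNReal.rpow_two, mul_pow, ← ENNReal.ofReal_pow (Real.exp_pos _).le, ← Real.exp_nat_mul]
    congr 3
    push_cast
    ring
  simp only [Pi.mul_apply, e0, e1, e2] at h
  have h2 := pow_le_pow_left₀ zero_le h 2
  refine h2.trans ?_
  rw [mul_pow, ← ENNReal.rpow_two, ← ENNReal.rpow_two, ← ENNReal.rpow_mul, ← ENNReal.rpow_mul]
  norm_num
  gcongr
  exact lintegral_exp_Ioc_le ha hx

theorem lintegral_weight (a : ℝ) {g : ℝ → ℝ≥0∞} (hg : Measurable g) :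
    ∫⁻ x, g x ∂weightMeasure a
      = ∫⁻ x in Ioi (0 : ℝ), ENNReal.ofReal (Real.exp (-2 * a * x)) * g x := by
  rw [weightMeasure, lintegral_withDensity_eq_lintegral_mul _ (by fun_prop) hg]
  rfl

/-- A weighted Hardy inequality. -/
theorem lintegral_sq_primitive_le {a : ℝ} (ha : 0 < a) {g : ℝ → ℝ≥0∞} (hg : Measurable g) :
    ∫⁻ x in Ioi (0 : ℝ), ENNReal.ofReal (Real.exp (-2 * a * x)) * (∫⁻ y in Ioc 0 x, g y) ^ 2
      ≤ ENNReal.ofReal (1 / a) ^ 2 *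
        ∫⁻ y in Ioi (0 : ℝ), ENNReal.ofReal (Real.exp (-2 * a * y)) * g y ^ 2 := by
  set G : ℝ → ℝ → ℝ≥0∞ := fun x y => (Iic x).indicator
    (fun y => ENNReal.ofReal (Real.exp (-a * x)) * (ENNReal.ofReal (Real.exp (-a * y)) * g y ^ 2)) y
    with hG
  have hGm : Measurable (Function.uncurry G) := by
    have : Function.uncurry G = {p : ℝ × ℝ | p.2 ≤ p.1}.indicator
        (fun p => ENNReal.ofReal (Real.exp (-a * p.1)) *
          (ENNReal.ofReal (Real.exp (-a * p.2)) * g p.2 ^ 2)) := by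
      ext p; simp [G, indicator, Function.uncurry]
    rw [this]
    exact Measurable.indicator (by fun_prop) (measurableSet_le measurable_snd measurable_fst)
  have h1 : ∀ x ∈ Ioi (0 : ℝ),
      ENNReal.ofReal (Real.exp (-2 * a * x)) * (∫⁻ y in Ioc 0 x, g y) ^ 2
        ≤ ENNReal.ofReal (1 / a) * ∫⁻ y in Ioi (0 : ℝ), G x y := by
    intro x hx
    have e : ∫⁻ y in Ioi (0 : ℝ), G x y = ENNReal.ofReal (Real.exp (-a * x)) *
        ∫⁻ y in Ioc 0 x, ENNReal.ofReal (Real.exp (-a * y)) * g y ^ 2 := by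
      rw [hG, lintegral_indicator measurableSet_Iic, Measure.restrict_restrict measurableSet_Iic,
        inter_comm, Ioi_inter_Iic, lintegral_const_mul _ (by fun_prop)]
    rw [e]
    refine (mul_le_mul_right (sq_lintegral_le ha hg (le_of_lt hx)) _).trans ?_
    rw [← mul_assoc, ← mul_assoc, ← ENNReal.ofReal_mul (Real.exp_pos _).le,
      ← ENNReal.ofReal_mul (by positivity)]
    refine mul_le_mul_left (ENNReal.ofReal_le_ofReal (le_of_eq ?_)) _
    rw [mul_div_assoc', ← Real.exp_add, div_mul_eq_mul_div, one_mul]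
    congr 2
    ring
  refine (setLIntegral_mono' measurableSet_Ioi h1).trans ?_
  have hGm' : Measurable fun x => ∫⁻ y in Ioi (0 : ℝ), G x y := hGm.lintegral_prod_right'
  -- After the exchange, the integral of `e^{-ax}` over `x ≥ y` supplies the second factor `1/a` and
  -- restores the weight `e^{-2ay}`.
  rw [lintegral_const_mul _ hGm', lintegral_lintegral_swap hGm.aemeasurable,
    sq, mul_assoc]
  refine mul_le_mul_right ?_ _
  rw [← lintegral_const_mul _ (by fun_prop)]
  refine setLIntegral_mono' measurableSet_Ioi fun y hy => ?_
  have e : (fun x => G x y) = (Ici y).indicator (fun x => ENNReal.ofReal (Real.exp (-a * x)) *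
      (ENNReal.ofReal (Real.exp (-a * y)) * g y ^ 2)) := by
    ext x; simp [G, indicator]
  rw [e, lintegral_indicator measurableSet_Ici, lintegral_mul_const _ (by fun_prop)]
  have h2 : ∫⁻ x in Ici y, ENNReal.ofReal (Real.exp (-a * x)) ∂volume.restrict (Ioi 0)
      ≤ ENNReal.ofReal (Real.exp (-a * y) / a) := by
    rw [← lintegral_exp_neg_Ici ha]
    exact lintegral_mono' (Measure.restrict_mono_measure Measure.restrict_le_self _) le_rfl
  refine (mul_le_mul_left h2 _).trans ?_
  rw [← mul_assoc, ← mul_assoc, ← ENNReal.ofReal_mul (by positivity),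
    ← ENNReal.ofReal_mul (by positivity)]
  refine mul_le_mul_left (ENNReal.ofReal_le_ofReal (le_of_eq ?_)) _
  have : Real.exp (-2 * a * y) = Real.exp (-a * y) * Real.exp (-a * y) := by
    rw [← Real.exp_add]; ring_nf
  rw [this]
  ring

theorem aestronglyMeasurable_causalConv {a : ℝ} {k v : ℝ → ℝ} (hk : Continuous k)
    (hv : StronglyMeasurable v) :
    AEStronglyMeasurable (causalConv k v) (weightMeasure a) := by
  have h1 : StronglyMeasurable fun x => ∫ y, ({p : ℝ × ℝ | 0 < p.2 ∧ p.2 ≤ p.1}.indicator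
      (fun p => k (p.1 - p.2) * v p.2)) (x, y) := by
    apply StronglyMeasurable.integral_prod_right
    refine StronglyMeasurable.indicator ?_ ?_
    · exact ((hk.comp (continuous_fst.sub continuous_snd)).stronglyMeasurable).mul
        (hv.comp_measurable measurable_snd)
    · exact (measurableSet_lt measurable_const measurable_snd).inter
        (measurableSet_le measurable_snd measurable_fst)
  refine h1.aestronglyMeasurable.congr ?_
  rw [EventuallyEq, ae_weight_iff]
  filter_upwards [ae_restrict_mem measurableSet_Ioi] with x hx
  rw [causalConv, intervalIntegral.integral_of_le (le_of_lt hx),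
    ← integral_indicator measurableSet_Ioc]
  rfl

/-- Pointwise, the convolution is at most `C ∫₀ˣ |v|`, and the Hardy inequality applies. -/
theorem eLpNorm_causalConv_le {a : ℝ} (ha : 0 < a) {k v : ℝ → ℝ} {C : ℝ}
    (hk : Continuous k) (hkC : ∀ x, |k x| ≤ C) (hv : StronglyMeasurable v) :
    eLpNorm (causalConv k v) 2 (weightMeasure a)
      ≤ ENNReal.ofReal (C / a) * eLpNorm v 2 (weightMeasure a) := by
  have hC : 0 ≤ C := (abs_nonneg _).trans (hkC 0)
  have hm := aestronglyMeasurable_causalConv (a := a) hk hv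
  have hg : Measurable fun y => ‖v y‖ₑ := hv.measurable.enorm
  rw [← ENNReal.pow_le_pow_left_iff (two_ne_zero), mul_pow]
  have e : ∀ f : ℝ → ℝ, eLpNorm f 2 (weightMeasure a) ^ 2 = ∫⁻ x, ‖f x‖ₑ ^ 2 ∂weightMeasure a := by
    intro f
    have := eLpNorm_nnreal_pow_eq_lintegral (f := f) (μ := weightMeasure a) (p := 2) two_ne_zero
    simpa using this
  rw [e, e]
  have hpm : Measurable fun x => ∫⁻ y in Ioc 0 x, ‖v y‖ₑ := by
    have : (fun x => ∫⁻ y in Ioc 0 x, ‖v y‖ₑ) = fun x => ∫⁻ y,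
        ({p : ℝ × ℝ | 0 < p.2 ∧ p.2 ≤ p.1}.indicator (fun p => ‖v p.2‖ₑ)) (x, y) := by
      ext x
      rw [← lintegral_indicator measurableSet_Ioc]
      rfl
    rw [this]
    refine Measurable.lintegral_prod_right' (f := fun p : ℝ × ℝ =>
      ({p : ℝ × ℝ | 0 < p.2 ∧ p.2 ≤ p.1}.indicator (fun p => ‖v p.2‖ₑ)) p) ?_
    exact Measurable.indicator (by fun_prop)
      ((measurableSet_lt measurable_const measurable_snd).inter
        (measurableSet_le measurable_snd measurable_fst))
  have h1 : ∫⁻ x, ‖causalConv k v x‖ₑ ^ 2 ∂weightMeasure a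
      ≤ ∫⁻ x, ENNReal.ofReal C ^ 2 * (∫⁻ y in Ioc 0 x, ‖v y‖ₑ) ^ 2 ∂weightMeasure a := by
    refine lintegral_mono_ae ?_
    rw [ae_weight_iff]
    filter_upwards [ae_restrict_mem measurableSet_Ioi] with x hx
    rw [← mul_pow]
    refine pow_le_pow_left₀ zero_le ?_ 2
    rw [causalConv, intervalIntegral.integral_of_le (le_of_lt hx)]
    refine (enorm_integral_le_lintegral_enorm _).trans ?_
    rw [← lintegral_const_mul _ hg]
    refine lintegral_mono fun y => ?_
    simp only [enorm_mul]
    gcongr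
    rw [Real.enorm_eq_ofReal_abs]
    exact ENNReal.ofReal_le_ofReal (hkC _)
  refine h1.trans ?_
  rw [lintegral_const_mul _ (hpm.pow_const 2), lintegral_weight a (hpm.pow_const 2),
    lintegral_weight a (hg.pow_const 2)]
  refine (mul_le_mul_right (lintegral_sq_primitive_le ha hg) _).trans ?_
  rw [← mul_assoc, ← mul_pow, ← ENNReal.ofReal_mul hC, mul_one_div]

theorem memLp_causalConv {a : ℝ} (ha : 0 < a) {k : ℝ → ℝ} {C : ℝ}
    (hk : Continuous k) (hkC : ∀ x, |k x| ≤ C) (v : L2 a) :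
    MemLp (causalConv k v) 2 (weightMeasure a) := by
  refine ⟨aestronglyMeasurable_causalConv hk (Lp.stronglyMeasurable v),
    (eLpNorm_causalConv_le ha hk hkC (Lp.stronglyMeasurable v)).trans_lt ?_⟩
  exact ENNReal.mul_lt_top ENNReal.ofReal_lt_top (Lp.memLp v).eLpNorm_lt_top

theorem causalConv_congr (k : ℝ → ℝ) {v w : ℝ → ℝ}
    (h : v =ᵐ[volume.restrict (Ioi (0 : ℝ))] w) {x : ℝ} (hx : 0 ≤ x) :
    causalConv k v x = causalConv k w x := by
  refine integral_congr_ae_Ioi ?_ hx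
  filter_upwards [h] with y hy
  rw [hy]

theorem intervalIntegrable_kernel_mul {k v : ℝ → ℝ} (hk : Continuous k) (hv : LocInt v) {x : ℝ}
    (hx : 0 ≤ x) : IntervalIntegrable (fun y => k (x - y) * v y) volume 0 x := by
  have := hv.clm_apply (S := fun y => k (x - y) • ContinuousLinearMap.id ℝ ℝ)
    (by have : Continuous fun y => k (x - y) := hk.comp (continuous_const.sub continuous_id)
        fun_prop)
  simpa using this.intervalIntegrable hx

/-- Causal convolution with a bounded kernel, as a bounded operator on `L²_a`. -/
noncomputable def convOp {a : ℝ} (ha : 0 < a) (k : ℝ → ℝ) (C : ℝ) (hk : Continuous k)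
    (hkC : ∀ x, |k x| ≤ C) : L2 a →L[ℝ] L2 a :=
  LinearMap.mkContinuous
    { toFun := fun v => (memLp_causalConv ha hk hkC v).toLp _
      map_add' := fun v w => by
        rw [← MemLp.toLp_add]
        apply MemLp.toLp_congr
        rw [EventuallyEq, ae_weight_iff]
        filter_upwards [ae_restrict_mem measurableSet_Ioi] with x hx
        have hx' : (0 : ℝ) ≤ x := le_of_lt hx
        rw [Pi.add_apply, causalConv_congr k ((ae_weight_iff a).1 (Lp.coeFn_add v w)) hx',
          causalConv, causalConv, causalConv, ← intervalIntegral.integral_add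
            (intervalIntegrable_kernel_mul hk (locInt_L2 ha v) hx')
            (intervalIntegrable_kernel_mul hk (locInt_L2 ha w) hx')]
        simp only [Pi.add_apply, mul_add]
      map_smul' := fun c v => by
        rw [RingHom.id_apply, ← MemLp.toLp_const_smul]
        apply MemLp.toLp_congr
        rw [EventuallyEq, ae_weight_iff]
        filter_upwards [ae_restrict_mem measurableSet_Ioi] with x hx
        rw [Pi.smul_apply, causalConv_congr k ((ae_weight_iff a).1 (Lp.coeFn_smul c v))
          (le_of_lt hx), causalConv, causalConv, ← intervalIntegral.integral_smul]
        simp only [Pi.smul_apply, smul_eq_mul, mul_left_comm] }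
    (C / a) fun v => by
      have hC : 0 ≤ C := (abs_nonneg _).trans (hkC 0)
      simp only [LinearMap.coe_mk, AddHom.coe_mk]
      rw [Lp.norm_toLp, Lp.norm_def, ← ENNReal.toReal_ofReal (div_nonneg hC ha.le),
        ← ENNReal.toReal_mul]
      exact ENNReal.toReal_mono
        (ENNReal.mul_lt_top ENNReal.ofReal_lt_top (Lp.memLp v).eLpNorm_lt_top).ne
        (eLpNorm_causalConv_le ha hk hkC (Lp.stronglyMeasurable v))

theorem convOp_ae {a : ℝ} (ha : 0 < a) {k : ℝ → ℝ} {C : ℝ} (hk : Continuous k)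
    (hkC : ∀ x, |k x| ≤ C) (v : L2 a) :
    convOp ha k C hk hkC v =ᵐ[volume.restrict (Ioi (0 : ℝ))] causalConv k v :=
  (ae_weight_iff a).1 (memLp_causalConv ha hk hkC v).coeFn_toLp

/-! ## Primitives and boundary values -/

/-- `v(x) = c + ∫₀ˣ w`. -/
def IsPrimitive {a : ℝ} (v w : L2 a) (c : ℝ) : Prop :=
  v =ᵐ[volume.restrict (Ioi (0 : ℝ))] fun x => c + ∫ s in (0 : ℝ)..x, w s

theorem hasWeakDeriv_primitive {h : ℝ → ℝ} (hh : LocInt h) (c : ℝ) :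
    HasWeakDeriv (fun x => c + ∫ s in (0 : ℝ)..x, h s) h := by
  refine ⟨(locInt_of_continuousOn (continuousOn_const.add
    hh.continuousOn_primitive)).locallyIntegrableOn, hh.locallyIntegrableOn, fun φ hφ hc hs => ?_⟩
  have := integral_deriv_smul_primitive hh c hφ hc
  rw [image_eq_zero_of_notMem_tsupport fun h => lt_irrefl (0 : ℝ) (hs h)] at this
  simpa using this

theorem HasWeakDeriv.unique {g h h' : ℝ → ℝ} (H : HasWeakDeriv g h) (H' : HasWeakDeriv g h') :
    h =ᵐ[volume.restrict (Ioi (0 : ℝ))] h' := by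
  have hl : LocallyIntegrableOn (fun x => h x - h' x) (Ioi 0) := by
    have h1 := H.2.1
    have h2 := H'.2.1
    rw [locallyIntegrableOn_iff isOpen_Ioi.isLocallyClosed] at *
    exact fun K hK hKc => (h1 K hK hKc).sub (h2 K hK hKc)
  have key := isOpen_Ioi.ae_eq_zero_of_integral_contDiff_smul_eq_zero (μ := volume) hl ?_
  · rw [EventuallyEq, ae_restrict_iff' measurableSet_Ioi]
    filter_upwards [key] with t ht hts
    exact sub_eq_zero.1 (ht hts)
  intro φ hφ hc hs
  have int : ∀ {p : ℝ → ℝ}, LocallyIntegrableOn p (Ioi 0) →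
      IntegrableOn (fun x => φ x * p x) (Ioi 0) := by
    intro p hp
    rw [locallyIntegrableOn_iff isOpen_Ioi.isLocallyClosed] at hp
    obtain ⟨C, hC⟩ := hφ.continuous.bounded_above_of_compact_support hc
    have h1 : IntegrableOn (fun x => φ x * p x) (tsupport φ) :=
      (hp _ hs hc.isCompact).bdd_mul hφ.continuous.aestronglyMeasurable
        (Eventually.of_forall hC)
    refine h1.of_forall_sdiff_eq_zero measurableSet_Ioi fun x hx => ?_
    rw [image_eq_zero_of_notMem_tsupport hx.2, zero_mul]
  rw [← setIntegral_eq_integral_of_forall_compl_eq_zero (s := Ioi 0)]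
  · simp only [smul_eq_mul, mul_sub]
    rw [integral_sub (int H.2.1) (int H'.2.1)]
    have h1 := H.2.2 φ hφ hc hs
    have h2 := H'.2.2 φ hφ hc hs
    linarith
  · intro x hx
    rw [image_eq_zero_of_notMem_tsupport fun h => hx (hs h), zero_smul]

theorem IsPrimitive.hasWeakDeriv {a : ℝ} (ha : 0 < a) {v w : L2 a} {c : ℝ}
    (h : IsPrimitive v w c) : HasWeakDeriv v w :=
  (hasWeakDeriv_primitive (locInt_L2 ha w) c).congr (EventuallyEq.symm h) (EventuallyEq.refl _ _)

theorem exists_isPrimitive {a : ℝ} (ha : 0 < a) {v w : L2 a} (h : HasWeakDeriv v w) :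
    ∃ c, IsPrimitive v w c :=
  exists_eq_primitive (locInt_L2 ha v) (locInt_L2 ha w) fun φ hφ hc hs => h.2.2 φ hφ hc hs

theorem IsPrimitive.hasTrace {a : ℝ} (ha : 0 < a) {v w : L2 a} {c : ℝ}
    (h : IsPrimitive v w c) : HasTrace v c :=
  ⟨_, continuousOn_const.add (locInt_L2 ha w).continuousOn_primitive, h, by simp⟩

/-- A fixed cutoff function, equal to `1` at the boundary. -/
noncomputable def cutoff : ContDiffBump (0 : ℝ) := ⟨1, 2, one_pos, one_lt_two⟩

/-- The boundary value of `v` as a functional of `v` and its weak derivative `w`. -/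
noncomputable def boundaryValue (a : ℝ) : L2 a × L2 a →L[ℝ] ℝ :=
  -((innerSL ℝ ((memLp_test a ((cutoff.contDiff (n := ⊤)).continuous_deriv (by simp))
      cutoff.hasCompactSupport.deriv).toLp _)).comp (ContinuousLinearMap.fst ℝ _ _) +
    (innerSL ℝ ((memLp_test a cutoff.continuous cutoff.hasCompactSupport).toLp _)).comp
      (ContinuousLinearMap.snd ℝ _ _))

/-- Integration by parts against the cutoff, whose value at `0` is `1`. The boundary value is
thereby a continuous functional of the pair `(v, ∂ₓv)`. -/
theorem IsPrimitive.boundaryValue_eq {a : ℝ} (ha : 0 < a) {v w : L2 a} {c : ℝ}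
    (h : IsPrimitive v w c) : boundaryValue a (v, w) = c := by
  have h1 := integral_deriv_smul_primitive (locInt_L2 ha w) c (cutoff.contDiff (n := ⊤))
    cutoff.hasCompactSupport
  have h0 : cutoff (0 : ℝ) = 1 :=
    cutoff.one_of_mem_closedBall (Metric.mem_closedBall_self zero_le_one)
  have h2 : ∫ x in Ioi (0 : ℝ), deriv cutoff x * v x
      = ∫ x in Ioi (0 : ℝ), deriv cutoff x • (c + ∫ s in (0 : ℝ)..x, w s) := by
    refine integral_congr_ae ?_
    filter_upwards [h] with x hx
    rw [hx, smul_eq_mul]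
  have e : boundaryValue a (v, w) = -((∫ x in Ioi (0 : ℝ), deriv cutoff x * v x) +
      ∫ x in Ioi (0 : ℝ), cutoff x * w x) := by
    rw [integral_test_eq_inner ((cutoff.contDiff (n := ⊤)).continuous_deriv (by simp))
      cutoff.hasCompactSupport.deriv, integral_test_eq_inner cutoff.continuous
      cutoff.hasCompactSupport]
    rfl
  rw [e, h2, h1, h0]
  simp

theorem isPrimitive_boundaryValue {a : ℝ} (ha : 0 < a) {v w : L2 a} (h : HasWeakDeriv v w) :
    IsPrimitive v w (boundaryValue a (v, w)) := by
  obtain ⟨c, hc⟩ := exists_isPrimitive ha h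
  rwa [hc.boundaryValue_eq ha]

/-- The pairs `(v, ∂ₓv)`. -/
def weakDerivGraph (a : ℝ) : Submodule ℝ (L2 a × L2 a) where
  carrier := {p | HasWeakDeriv p.1 p.2}
  add_mem' := by
    intro v w hv hw
    have h1 := (hasWeakDeriv_L2_iff _ _).1 hv
    have h2 := (hasWeakDeriv_L2_iff _ _).1 hw
    refine (hasWeakDeriv_L2_iff _ _).2 fun φ hφ hc hs => ?_
    rw [Prod.fst_add, Prod.snd_add, inner_add_right, inner_add_right, h1 φ hφ hc hs,
      h2 φ hφ hc hs]
    ring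
  zero_mem' := by
    refine (hasWeakDeriv_L2_iff _ _).2 fun φ hφ hc hs => ?_
    simp
  smul_mem' := by
    intro c v hv
    have h1 := (hasWeakDeriv_L2_iff _ _).1 hv
    refine (hasWeakDeriv_L2_iff _ _).2 fun φ hφ hc hs => ?_
    rw [Prod.smul_fst, Prod.smul_snd, inner_smul_right, inner_smul_right, h1 φ hφ hc hs]
    simp

/-! ## The operator `v ↦ ∂ₓ(𝒦⁰_μ * v)` -/

section Operator

variable {μ a : ℝ} (hμ : 0 < μ) (ha : 0 < a)

theorem memLp_kernelDeriv (hμ : 0 < μ) (ha : 0 < a) (m : ℕ) :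
    MemLp (kernelDeriv μ m) 2 (weightMeasure a) := by
  have := isFiniteMeasure_weight ha
  exact MemLp.of_bound (continuous_kernelDeriv μ m).aestronglyMeasurable _
    (Eventually.of_forall fun x => abs_kernelDeriv_le hμ m x)

/-- The `m`-th derivative of the kernel, in `L²_a`. -/
noncomputable def kernelL2 (m : ℕ) : L2 a := (memLp_kernelDeriv hμ ha m).toLp _

theorem kernelL2_ae (m : ℕ) :
    kernelL2 hμ ha m =ᵐ[volume.restrict (Ioi (0 : ℝ))] kernelDeriv μ m :=
  (ae_weight_iff a).1 (memLp_kernelDeriv hμ ha m).coeFn_toLp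

theorem isPrimitive_kernelL2 (m : ℕ) :
    IsPrimitive (kernelL2 hμ ha m) (kernelL2 hμ ha (m + 1)) (kernelDeriv μ m 0) := by
  filter_upwards [kernelL2_ae hμ ha m, ae_restrict_mem measurableSet_Ioi] with x hx h0
  rw [hx, integral_congr_ae_Ioi (kernelL2_ae hμ ha (m + 1)) (le_of_lt h0), integral_kernelDeriv]
  ring

/-- The bounded operator `v ↦ ∂ₓ(𝒦⁰_μ * v) = κ⁻¹ v + (𝒦⁰_μ)' * v` on `L²_a`. -/
noncomputable def convDeriv : L2 a →L[ℝ] L2 a :=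
  (kappa μ)⁻¹ • ContinuousLinearMap.id ℝ (L2 a) +
    convOp ha (kernelDeriv μ 1) _ (continuous_kernelDeriv μ 1) (abs_kernelDeriv_le hμ 1)

theorem convDeriv_ae (v : L2 a) : convDeriv hμ ha v =ᵐ[volume.restrict (Ioi (0 : ℝ))]
    fun x => (kappa μ)⁻¹ * v x + causalConv (kernelDeriv μ 1) v x := by
  have h1 := (ae_weight_iff a).1 (Lp.coeFn_add ((kappa μ)⁻¹ • v)
    (convOp ha (kernelDeriv μ 1) _ (continuous_kernelDeriv μ 1) (abs_kernelDeriv_le hμ 1) v))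
  have h2 := (ae_weight_iff a).1 (Lp.coeFn_smul (kappa μ)⁻¹ v)
  filter_upwards [h1, h2,
    convOp_ae ha (continuous_kernelDeriv μ 1) (abs_kernelDeriv_le hμ 1) v] with x e1 e2 e3
  rw [← e3, ← smul_eq_mul]
  change _ = ((kappa μ)⁻¹ • (v : ℝ → ℝ)) x + _
  rw [← e2]
  exact e1

/-- Write `K(x - y) = 1/κ + ∫_y^x K'(z - y) dz` and exchange the integrals. No regularity of `v` is
needed, and no constant appears. -/
theorem causalConv_kernel_eq (v : L2 a) {x : ℝ} (hx : 0 ≤ x) :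
    causalConv (kernelK0 μ) v x = ∫ s in (0 : ℝ)..x, convDeriv hμ ha v s := by
  have hv := locInt_L2 ha v
  have hk1 : LocInt (causalConv (kernelDeriv μ 1) v) :=
    (locInt_L2 ha _).congr
      (convOp_ae ha (continuous_kernelDeriv μ 1) (abs_kernelDeriv_le hμ 1) v)
  rw [integral_congr_ae_Ioi (convDeriv_ae hμ ha v) hx, intervalIntegral.integral_add
    ((hv.intervalIntegrable hx).const_mul _) (hk1.intervalIntegrable hx)]
  have ht := integral_triangle_swap (m := fun z y => kernelDeriv μ 1 (z - y)) (w := v)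
    ((continuous_kernelDeriv μ 1).comp (continuous_fst.sub continuous_snd)) hx
    (hv.integrableOn_Ioc x)
  simp only [smul_eq_mul] at ht
  simp only [causalConv, ht]
  rw [intervalIntegral.integral_const_mul, ← intervalIntegral.integral_const_mul,
    ← intervalIntegral.integral_add]
  · apply intervalIntegral.integral_congr
    intro y _
    simp only
    rw [intervalIntegral.integral_comp_sub_right (kernelDeriv μ 1), integral_kernelDeriv, sub_self,
      kernelDeriv_zero_zero, kernelDeriv_zero]
    ring
  · exact (hv.intervalIntegrable hx).const_mul _
  · have : ∀ y, ∫ z in y..x, kernelDeriv μ 1 (z - y)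
        = (fun z => kernelDeriv μ 0 z - kernelDeriv μ 0 0) (x - y) := by
      intro y
      rw [intervalIntegral.integral_comp_sub_right (kernelDeriv μ 1), integral_kernelDeriv, sub_self]
    simp only [this]
    exact intervalIntegrable_kernel_mul
      (k := fun z => kernelDeriv μ 0 z - kernelDeriv μ 0 0)
      ((continuous_kernelDeriv μ 0).sub continuous_const) hv hx

theorem hasWeakDeriv_causalConv (v : L2 a) :
    HasWeakDeriv (causalConv (kernelK0 μ) v) (convDeriv hμ ha v) := by
  refine (hasWeakDeriv_primitive (locInt_L2 ha (convDeriv hμ ha v)) 0).congr ?_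
    (EventuallyEq.refl _ _)
  filter_upwards [ae_restrict_mem measurableSet_Ioi] with x hx
  rw [zero_add, causalConv_kernel_eq hμ ha v (le_of_lt hx)]

/-- The commutator identity `∂ₓ(A v) = A ∂ₓv + v(0) K'`. The boundary value comes from the local
term `v/κ` alone, as the convolution vanishes at `0`. -/
theorem isPrimitive_convDeriv {v w : L2 a} {c : ℝ} (h : IsPrimitive v w c) :
    IsPrimitive (convDeriv hμ ha v) (convDeriv hμ ha w + c • kernelL2 hμ ha 1)
      (c * (kappa μ)⁻¹) := by
  have hw := locInt_L2 ha w
  have hAw := locInt_L2 ha (convDeriv hμ ha w)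
  have hs : (convDeriv hμ ha w + c • kernelL2 hμ ha 1 : L2 a) =ᵐ[volume.restrict (Ioi (0 : ℝ))]
      fun x => convDeriv hμ ha w x + c * kernelDeriv μ 1 x := by
    have h1 := (ae_weight_iff a).1 (Lp.coeFn_add (convDeriv hμ ha w) (c • kernelL2 hμ ha 1))
    have h2 := (ae_weight_iff a).1 (Lp.coeFn_smul c (kernelL2 hμ ha 1))
    filter_upwards [h1, h2, kernelL2_ae hμ ha 1] with x e1 e2 e3
    rw [e1, Pi.add_apply, e2, Pi.smul_apply, e3, smul_eq_mul]
  filter_upwards [convDeriv_ae hμ ha v, h, ae_restrict_mem measurableSet_Ioi] with x e1 e2 hx0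
  have hx : (0 : ℝ) ≤ x := le_of_lt hx0
  have hk := continuous_kernelDeriv μ 1
  have hki : IntervalIntegrable (fun s => c * kernelDeriv μ 1 s) volume 0 x :=
    (continuous_const.mul hk).intervalIntegrable _ _
  rw [integral_congr_ae_Ioi hs hx, intervalIntegral.integral_add (hAw.intervalIntegrable hx) hki,
    ← causalConv_kernel_eq hμ ha w hx, intervalIntegral.integral_const_mul, integral_kernelDeriv,
    kernelDeriv_zero_zero, e1, e2, causalConv_congr _ h hx]
  have hkx : Continuous fun z => kernelDeriv μ 1 (x - z) := hk.comp (continuous_const.sub continuous_id)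
  have i1 : IntervalIntegrable (fun z => kernelDeriv μ 1 (x - z) * c) volume 0 x :=
    (hkx.mul continuous_const).intervalIntegrable _ _
  have i2 : IntervalIntegrable (fun z => kernelDeriv μ 1 (x - z) * ∫ s in (0 : ℝ)..z, w s)
      volume 0 x := by
    apply ContinuousOn.intervalIntegrable
    rw [uIcc_of_le hx]
    exact hkx.continuousOn.mul (hw.continuousOn_primitive.mono Icc_subset_Ici_self)
  have hI : ∀ y, ∫ z in y..x, kernelDeriv μ 1 (x - z) = kernelDeriv μ 0 (x - y) - (kappa μ)⁻¹ := by
    intro y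
    rw [intervalIntegral.integral_comp_sub_left (kernelDeriv μ 1), integral_kernelDeriv, sub_self,
      kernelDeriv_zero_zero]
  have ht := integral_triangle_swap (m := fun z _ => kernelDeriv μ 1 (x - z)) (w := w)
    (hkx.comp continuous_fst) hx (hw.integrableOn_Ioc x)
  simp only [smul_eq_mul, intervalIntegral.integral_const_mul, hI] at ht
  -- Both terms with `-(kappa μ)⁻¹` cancel the local part `(kappa μ)⁻¹ * (c + ∫ w)` of `convDeriv`,
  -- leaving `c K(x) + (K * w)(x)`.
  have e3 : causalConv (kernelDeriv μ 1) (fun z => c + ∫ s in (0 : ℝ)..z, w s) x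
      = c * (kernelDeriv μ 0 x - (kappa μ)⁻¹) + (causalConv (kernelK0 μ) w x
        - (kappa μ)⁻¹ * ∫ s in (0 : ℝ)..x, w s) := by
    simp only [causalConv, mul_add]
    rw [intervalIntegral.integral_add i1 i2, ht, intervalIntegral.integral_mul_const, hI,
      sub_zero, mul_comm c, ← kernelDeriv_zero, ← intervalIntegral.integral_const_mul,
      ← intervalIntegral.integral_sub
        (intervalIntegrable_kernel_mul (continuous_kernelDeriv μ 0) hw hx)
        ((hw.intervalIntegrable hx).const_mul _)]
    simp only [sub_mul]
  rw [e3]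
  ring

end Operator

/-! ## The operator on `H^k_a` -/

section Sobolev

variable {μ a : ℝ} (hμ : 0 < μ) (ha : 0 < a)

/-- `v ↦ ∂ₓⁱ v` from `H^k_a` to `L²_a`. -/
noncomputable def coordH (a : ℝ) (k : ℕ) (i : Fin (k + 1)) : H a k →L[ℝ] L2 a :=
  (PiLp.proj 1 (fun _ : Fin (k + 1) => L2 a) i : _ →L[ℝ] L2 a).comp (sobolevSpace a k).subtypeL

theorem coordH_zero {k : ℕ} (V : H a k) : coordH a k 0 V = toL2 V := rfl

theorem hasWeakDeriv_coordH {k : ℕ} (V : H a k) (i : Fin k) :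
    HasWeakDeriv (coordH a k i.castSucc V) (coordH a k i.succ V) := V.2 i

/-- The boundary value of `∂ₓⁱ v`. -/
noncomputable def traceH (a : ℝ) (k : ℕ) (i : Fin k) : H a k →L[ℝ] ℝ :=
  (boundaryValue a).comp ((coordH a k i.castSucc).prod (coordH a k i.succ))

theorem isPrimitive_traceH (ha : 0 < a) {k : ℕ} (V : H a k) (i : Fin k) :
    IsPrimitive (coordH a k i.castSucc V) (coordH a k i.succ V) (traceH a k i V) :=
  isPrimitive_boundaryValue ha (hasWeakDeriv_coordH V i)

theorem hasTrace_traceH (ha : 0 < a) {k : ℕ} (V : H a (k + 1)) : HasTrace (toL2 V) (traceH a (k + 1) 0 V) :=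
  (isPrimitive_traceH ha V 0).hasTrace ha

/-- The `i`-th derivative of `∂ₓ(𝒦⁰_μ * v)`, for `v ∈ H^k_a`. -/
noncomputable def convDerivCoord (k : ℕ) (i : Fin (k + 1)) : H a k →L[ℝ] L2 a :=
  (convDeriv hμ ha).comp (coordH a k i) +
    ∑ j : Fin k, if (j : ℕ) < i then
      (traceH a k j).smulRight (kernelL2 hμ ha ((i : ℕ) - j)) else 0

theorem convDerivCoord_apply (k : ℕ) (i : Fin (k + 1)) (V : H a k) :
    convDerivCoord hμ ha k i V = convDeriv hμ ha (coordH a k i V) +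
      ∑ j : Fin k, if (j : ℕ) < i then
        traceH a k j V • kernelL2 hμ ha ((i : ℕ) - j) else 0 := by
  rw [convDerivCoord, add_apply, ContinuousLinearMap.comp_apply, sum_apply]
  congr 1
  refine Finset.sum_congr rfl fun j _ => ?_
  split_ifs <;> rfl

/-- One more derivative raises the order of the kernel in each existing boundary term by one, and
commuting with `A` creates the new term `j = i`, with kernel `K'`. -/
theorem hasWeakDeriv_convDerivCoord {k : ℕ} (V : H a k) (i : Fin k) :
    HasWeakDeriv (convDerivCoord hμ ha k i.castSucc V) (convDerivCoord hμ ha k i.succ V) := by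
  set g : Fin k → L2 a × L2 a := fun j =>
    if (j : ℕ) < i then traceH a k j V •
      (kernelL2 hμ ha ((i : ℕ) - j), kernelL2 hμ ha ((i : ℕ) + 1 - j)) else 0 with hg
  have h1 : (convDeriv hμ ha (coordH a k i.castSucc V),
      convDeriv hμ ha (coordH a k i.succ V) + traceH a k i V • kernelL2 hμ ha 1)
        ∈ weakDerivGraph a :=
    (isPrimitive_convDeriv hμ ha (isPrimitive_traceH ha V i)).hasWeakDeriv ha
  have h2 : ∀ j ∈ Finset.univ, g j ∈ weakDerivGraph a := by
    intro j _
    simp only [hg]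
    split_ifs with hj
    · refine (weakDerivGraph a).smul_mem _ ?_
      have := (isPrimitive_kernelL2 hμ ha ((i : ℕ) - j)).hasWeakDeriv ha
      rwa [← Nat.sub_add_comm hj.le] at this
    · exact (weakDerivGraph a).zero_mem
  have h3 := (weakDerivGraph a).add_mem h1 ((weakDerivGraph a).sum_mem h2)
  have e1 : convDerivCoord hμ ha k i.castSucc V
      = convDeriv hμ ha (coordH a k i.castSucc V) + (∑ j, g j).1 := by
    rw [convDerivCoord_apply, Prod.fst_sum]
    congr 1
    refine Finset.sum_congr rfl fun j _ => ?_
    simp only [hg, Fin.val_castSucc]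
    split_ifs <;> rfl
  have e2 : convDerivCoord hμ ha k i.succ V
      = convDeriv hμ ha (coordH a k i.succ V) + traceH a k i V • kernelL2 hμ ha 1
        + (∑ j, g j).2 := by
    rw [convDerivCoord_apply, Prod.snd_sum, add_assoc]
    congr 1
    -- The new term is spread over the index set so that the two sums can be compared termwise.
    have e3 : traceH a k i V • kernelL2 hμ ha 1 =
        ∑ j : Fin k, if j = i then traceH a k j V • kernelL2 hμ ha 1 else 0 := by
      simp
    rw [e3, ← Finset.sum_add_distrib]
    refine Finset.sum_congr rfl fun j _ => ?_
    simp only [hg, Fin.val_succ]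
    rcases lt_trichotomy (j : ℕ) i with h | h | h
    · have : j ≠ i := fun e => by rw [e] at h; exact lt_irrefl _ h
      simp [h, this, Nat.lt_succ_of_lt h]
    · have : j = i := Fin.ext h
      subst this
      simp
    · have : j ≠ i := fun e => by rw [e] at h; exact lt_irrefl _ h
      have h' : ¬ (j : ℕ) < i + 1 := by omega
      simp [h.not_gt, this, h']
  rw [e1, e2]
  exact h3

/-- The derivatives of `∂ₓ(𝒦⁰_μ * v)`, for `v ∈ H^k_a`. -/
noncomputable def convDerivFamily (k : ℕ) : H a k →L[ℝ] PiLp 1 fun _ : Fin (k + 1) => L2 a :=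
  ((PiLp.continuousLinearEquiv 1 ℝ fun _ : Fin (k + 1) => L2 a).symm : _ →L[ℝ] _).comp
    (ContinuousLinearMap.pi fun i => convDerivCoord hμ ha k i)

theorem convDerivFamily_apply (k : ℕ) (V : H a k) (i : Fin (k + 1)) :
    convDerivFamily hμ ha k V i = convDerivCoord hμ ha k i V := rfl

theorem convDerivFamily_mem (k : ℕ) (V : H a k) :
    convDerivFamily hμ ha k V ∈ sobolevSpace a k := by
  change ∀ i : Fin k, HasWeakDeriv (convDerivFamily hμ ha k V i.castSucc)
    (convDerivFamily hμ ha k V i.succ)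
  intro i
  rw [convDerivFamily_apply, convDerivFamily_apply]
  exact hasWeakDeriv_convDerivCoord hμ ha V i

/-- The bounded operator `v ↦ ∂ₓ(𝒦⁰_μ * v)` on `H^k_a`. -/
noncomputable def convDerivH (k : ℕ) : H a k →L[ℝ] H a k :=
  (convDerivFamily hμ ha k).codRestrict (sobolevSpace a k) (convDerivFamily_mem hμ ha k)

theorem coordH_convDerivH (k : ℕ) (i : Fin (k + 1)) (V : H a k) :
    coordH a k i (convDerivH hμ ha k V) = convDerivCoord hμ ha k i V := rfl

theorem coordH_zero_convDerivH (k : ℕ) (V : H a k) :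
    coordH a k 0 (convDerivH hμ ha k V) = convDeriv hμ ha (coordH a k 0 V) := by
  rw [coordH_convDerivH, convDerivCoord_apply]
  simp

/-- Both sides are boundary values of the same `L²_a` function. This closes the equation at `x = 0`
into a scalar one. -/
theorem traceH_convDerivH (hμ : 0 < μ) (ha : 0 < a) (k : ℕ) (V : H a (k + 1)) :
    traceH a (k + 1) 0 (convDerivH hμ ha (k + 1) V) = (kappa μ)⁻¹ * traceH a (k + 1) 0 V := by
  have h1 := hasTrace_traceH ha (convDerivH hμ ha (k + 1) V)
  have h2 := (isPrimitive_convDeriv hμ ha (isPrimitive_traceH ha V 0)).hasTrace ha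
  rw [← coordH_zero, coordH_zero_convDerivH] at h1
  rw [mul_comm]
  exact h1.unique h2

/-- The inclusion of `H^k_a` in `H^l_a`, `l ≤ k`. -/
def restrictH {k l : ℕ} (h : l ≤ k) (V : H a k) : H a l :=
  ⟨WithLp.toLp 1 fun i => (V : PiLp 1 fun _ : Fin (k + 1) => L2 a) (Fin.castLE (by omega) i),
    fun i => V.2 (Fin.castLE h i)⟩

end Sobolev

/-! ## The solution of the initial value problem -/

section Solution

variable {μ a : ℝ} (hμ : 0 < μ) (ha : 0 < a) {f : ℝ → L2 a} {uin : L2 a}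

/-- A single `L²_a`-valued function represents the solutions built in all the spaces `H^k_a`. -/
theorem toL2_duhamel {k : ℕ} {F : ℝ → H a k} (hF : LocInt F)
    (hFf : ∀ᵐ t ∂volume.restrict (Ioi (0 : ℝ)), toL2 (F t) = f t) {V : H a k}
    (hV : toL2 V = uin) {t : ℝ} (ht : 0 ≤ t) :
    toL2 (duhamel (convDerivH hμ ha k) F V t) = duhamel (convDeriv hμ ha) f uin t := by
  rw [← coordH_zero, duhamel_intertwine (coordH_zero_convDerivH hμ ha k) hF V ht, coordH_zero, hV]
  exact duhamel_congr _ hFf _ ht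

theorem memCH_duhamel {q k : ℕ} {g : ℝ → L2 a} (hg : MemCH q k g)
    (hfg : f =ᵐ[volume.restrict (Ioi (0 : ℝ))] g) (huin : MemH k uin) :
    MemCH (q + 1) k (duhamel (convDeriv hμ ha) f uin) := by
  obtain ⟨G, hG, hGg⟩ := hg
  obtain ⟨V, hV⟩ := huin
  refine ⟨duhamel (convDerivH hμ ha k) G V, contDiffOn_duhamel _ hG _, fun t ht => ?_⟩
  refine toL2_duhamel hμ ha (locInt_of_continuousOn hG.continuousOn) ?_ hV ht
  filter_upwards [hfg, ae_restrict_mem measurableSet_Ioi] with t h h0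
  rw [h, hGg t (le_of_lt h0)]

theorem MemH.mono {k l : ℕ} (h : l ≤ k) (hu : MemH k uin) : MemH l uin := by
  obtain ⟨V, hV⟩ := hu
  exact ⟨restrictH h V, hV⟩

theorem exists_memCH_of_memWH {j k : ℕ} (hf : MemWH (j + 1) k f) :
    ∃ g : ℝ → L2 a, MemCH j k g ∧ f =ᵐ[volume.restrict (Ioi (0 : ℝ))] g := by
  obtain ⟨F, hF, hFf⟩ := hf
  obtain ⟨G, hG, hFG⟩ := memW1loc_exists_contDiffOn hF
  refine ⟨fun t => toL2 (G t), ⟨G, hG, fun t _ => rfl⟩, ?_⟩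
  filter_upwards [hFf, hFG] with t h1 h2
  rw [← h1, h2]

theorem memX_duhamel {n : ℕ} (hf : MemY n f) (huin : MemH n uin) :
    MemX n (duhamel (convDeriv hμ ha) f uin) := by
  intro j hj
  rcases j with _ | j
  · obtain ⟨F, ⟨D, rfl, hD, -⟩, hFf⟩ := hf 0 hj
    obtain ⟨V, hV⟩ := huin
    refine ⟨duhamel (convDerivH hμ ha n) (D 0) V, ?_, fun t ht => ?_⟩
    · rw [Nat.cast_zero, contDiffOn_zero]
      exact continuousOn_duhamel _ (hD 0 le_rfl) _
    · exact toL2_duhamel hμ ha (hD 0 le_rfl) hFf hV ht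
  -- At order `j + 1`, passing to a `C^j` representative of `f` costs one time derivative, which
  -- Duhamel's formula regains.
  · obtain ⟨g, hg, hfg⟩ := exists_memCH_of_memWH (hf (j + 1) hj)
    exact memCH_duhamel hμ ha hg hfg (huin.mono (Nat.sub_le _ _))

theorem MemCH.contDiffOn {j k : ℕ} {u : ℝ → L2 a} (hu : MemCH j k u) :
    ContDiffOn ℝ j u (Ici 0) := by
  obtain ⟨U, hU, hUu⟩ := hu
  exact ((coordH a k 0).contDiff.comp_contDiffOn hU).congr fun t ht => (hUu t ht).symm

theorem isSolution_duhamel {g : ℝ → L2 a} (hg : ContinuousOn g (Ici 0))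
    (hfg : f =ᵐ[volume.restrict (Ioi (0 : ℝ))] g) :
    IsSolution μ f uin (duhamel (convDeriv hμ ha) f uin) := by
  refine ⟨duhamel_zero _ _ _, ?_⟩
  filter_upwards [hfg, ae_restrict_mem measurableSet_Ioi] with t h h0
  have ht : (0 : ℝ) ≤ t := le_of_lt h0
  have e : ∀ t ∈ Ici (0 : ℝ), duhamel (convDeriv hμ ha) f uin t
      = duhamel (convDeriv hμ ha) g uin t := fun t ht => duhamel_congr _ hfg _ ht
  refine ⟨_, (hasDerivWithinAt_duhamel (convDeriv hμ ha) hg uin ht).congr e (e t ht), ?_⟩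
  refine (hasWeakDeriv_causalConv hμ ha _).congr (EventuallyEq.refl _ _) ?_
  filter_upwards [(ae_weight_iff a).1 (Lp.coeFn_sub (g t)
    (convDeriv hμ ha (duhamel (convDeriv hμ ha) g uin t)))] with x hx
  rw [hx, Pi.sub_apply, h, e t ht]
  ring

theorem isSolution_unique (hμ : 0 < μ) (ha : 0 < a) {u v : ℝ → L2 a} (hu : ContDiffOn ℝ 1 u (Ici 0))
    (hv : ContDiffOn ℝ 1 v (Ici 0)) (hus : IsSolution μ f uin u) (hvs : IsSolution μ f uin v)
    {t : ℝ} (ht : 0 ≤ t) : v t = u t := by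
  have eqn : ∀ {w : ℝ → L2 a}, IsSolution μ f uin w → ∀ᵐ t ∂volume.restrict (Ioi (0 : ℝ)),
      derivWithin w (Ici 0) t = f t - convDeriv hμ ha (w t) := by
    intro w hw
    filter_upwards [hw.2, ae_restrict_mem measurableSet_Ioi] with t ht h0
    obtain ⟨wt, hwt, hwd⟩ := ht
    rw [hwt.derivWithin (uniqueDiffOn_Ici 0 t (Ioi_subset_Ici_self h0))]
    -- Uniqueness of the weak `x`-derivative turns the equation into `w' = f - A w` in `L²_a`.
    have h1 := hwd.unique (hasWeakDeriv_causalConv hμ ha (w t))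
    apply Lp.ext
    rw [EventuallyEq, ae_weight_iff]
    filter_upwards [h1, (ae_weight_iff a).1 (Lp.coeFn_sub (f t) (convDeriv hμ ha (w t)))]
      with x e1 e2
    rw [e2, Pi.sub_apply, ← e1]
    ring
  have hd : ∀ {w : ℝ → L2 a}, ContDiffOn ℝ 1 w (Ici 0) → ∀ t, 0 ≤ t →
      HasDerivWithinAt w (derivWithin w (Ici 0) t) (Ici 0) t := fun hw t ht =>
    (hw.differentiableOn (by simp) t ht).hasDerivWithinAt
  have hdc : ∀ {w : ℝ → L2 a}, ContDiffOn ℝ 1 w (Ici 0) →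
      ContinuousOn (derivWithin w (Ici 0)) (Ici 0) := fun hw =>
    hw.continuousOn_derivWithin (uniqueDiffOn_Ici 0) le_rfl
  have hA : ∀ {w : ℝ → L2 a}, ContDiffOn ℝ 1 w (Ici 0) →
      ContinuousOn (fun t => convDeriv hμ ha (w t)) (Ici 0) := fun hw =>
    (convDeriv hμ ha).continuous.comp_continuousOn hw.continuousOn
  -- `f` cancels in the difference; both remaining sides are continuous in time, so equality almost
  -- everywhere becomes equality on `[0, ∞)`.
  have heq : EqOn (fun t => derivWithin v (Ici 0) t - derivWithin u (Ici 0) t)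
      (fun t => -(convDeriv hμ ha (v t) - convDeriv hμ ha (u t))) (Ici 0) := by
    refine Measure.eqOn_of_ae_eq (μ := volume) ?_ ((hdc hv).sub (hdc hu))
      ((hA hv).sub (hA hu)).neg (by simp)
    rw [← restrict_Ioi_eq_restrict_Ici]
    filter_upwards [eqn hus, eqn hvs] with t h1 h2
    rw [h1, h2]
    abel
  refine eqOn_of_linear_ode (A := convDeriv hμ ha) (hd hv) (hd hu) (hvs.1.trans hus.1.symm) ?_ ht
  intro t ht
  rw [map_sub]
  exact heq ht

theorem exp_smul_id_apply (r x : ℝ) :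
    NormedSpace.exp (r • ContinuousLinearMap.id ℝ ℝ) x = Real.exp r * x := by
  have h := NormedSpace.algebraMap_exp_comm (𝕂 := ℝ) (𝔸 := ℝ →L[ℝ] ℝ) r
  rw [Algebra.algebraMap_eq_smul_one, Algebra.algebraMap_eq_smul_one] at h
  change NormedSpace.exp (r • (1 : ℝ →L[ℝ] ℝ)) x = _
  rw [← h, Real.exp_eq_exp_ℝ]
  simp

theorem duhamel_scalar (r : ℝ) (F : ℝ → ℝ) (x t : ℝ) :
    duhamel (r • ContinuousLinearMap.id ℝ ℝ) F x t
      = Real.exp (-t * r) * x + ∫ s in (0 : ℝ)..t, Real.exp (-(t - s) * r) * F s := by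
  simp only [duhamel, smul_smul, exp_smul_id_apply]
  rw [mul_add, ← intervalIntegral.integral_const_mul]
  congr 2
  ext s
  rw [← mul_assoc, ← Real.exp_add]
  congr 2
  ring

/-- The trace functional is applied to Duhamel's formula in `H^{k+1}_a`, where it is continuous;
this also yields the local integrability of the traces of `f`. -/
theorem hasTrace_duhamel {k : ℕ} {F : ℝ → H a (k + 1)} (hF : LocInt F)
    (hFf : ∀ᵐ t ∂volume.restrict (Ioi (0 : ℝ)), toL2 (F t) = f t) {V : H a (k + 1)}
    (hV : toL2 V = uin) {t : ℝ} (ht : 0 ≤ t) :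
    IntervalIntegrable (fun s => Real.exp (-(t - s) / kappa μ) * trace (f s)) volume 0 t ∧
      HasTrace (duhamel (convDeriv hμ ha) f uin t) (Real.exp (-t / kappa μ) * trace uin +
        ∫ s in (0 : ℝ)..t, Real.exp (-(t - s) / kappa μ) * trace (f s)) := by
  have htr : ∀ᵐ s ∂volume.restrict (Ioi (0 : ℝ)), traceH a (k + 1) 0 (F s) = trace (f s) := by
    filter_upwards [hFf] with s hs
    rw [← hs, (hasTrace_traceH ha (F s)).trace_eq]
  have hl : LocInt fun s => trace (f s) := (hF.clm (traceH a (k + 1) 0)).congr htr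
  have h1 := duhamel_intertwine (A := convDerivH hμ ha (k + 1))
    (A' := (kappa μ)⁻¹ • ContinuousLinearMap.id ℝ ℝ) (S := traceH a (k + 1) 0)
    (fun V => by rw [traceH_convDerivH]; simp) hF V ht
  rw [duhamel_congr _ htr _ ht, duhamel_scalar, ← (hasTrace_traceH ha V).trace_eq, hV] at h1
  simp only [← div_eq_mul_inv] at h1
  refine ⟨?_, ?_⟩
  · exact intervalIntegrable_kernel_mul (k := fun s => Real.exp (-s / kappa μ)) (by fun_prop) hl ht
  · rw [← h1, ← toL2_duhamel hμ ha hF hFf hV ht]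
    exact hasTrace_traceH ha _

end Solution

end RLTransport

open RLTransport
theorem mainTheorem11 (μ : ℝ) (hμ : 0 < μ) (a : ℝ) (ha : 0 < a) (n : ℕ) (hn : n = 1 ∨ n = 2)
    (f : ℝ → L2 a) (hf : MemY n f) (uin : L2 a) (huin : MemH n uin) :
    ∃ u : ℝ → L2 a,
      -- existence and uniqueness in `𝕏ⁿ_a`
      (MemX n u ∧ IsSolution μ f uin u) ∧
      (∀ v : ℝ → L2 a, MemX n v → IsSolution μ f uin v → ∀ t, 0 ≤ t → v t = u t) ∧
      -- the boundary trace; all the boundary values and the integral in the formula make sense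
      HasTrace uin (trace uin) ∧
      (∀ᵐ s ∂volume.restrict (Ioi (0 : ℝ)), HasTrace (f s) (trace (f s))) ∧
      (∀ t, 0 ≤ t →
        IntervalIntegrable (fun s => Real.exp (-(t - s) / kappa μ) * trace (f s)) volume 0 t ∧
        HasTrace (u t) (Real.exp (-t / kappa μ) * trace uin +
          ∫ s in (0 : ℝ)..t, Real.exp (-(t - s) / kappa μ) * trace (f s))) ∧
      -- additional regularity in time
      ∀ q : ℕ,
        (∃ g : ℝ → L2 a, MemCH q n g ∧ ∀ᵐ t ∂volume.restrict (Ioi (0 : ℝ)), f t = g t) →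
          MemCH (q + 1) n u := by
  have hn1 : 1 ≤ n := by omega
  obtain ⟨k, rfl⟩ : ∃ k, n = k + 1 := ⟨n - 1, by omega⟩
  obtain ⟨F, ⟨D, rfl, hD, -⟩, hFf⟩ := hf 0 (Nat.zero_le _)
  have hF : LocInt (D 0) := hD 0 le_rfl
  obtain ⟨V, hV⟩ := huin
  -- The `W^{1,1}_loc` part of the hypothesis gives a time-continuous representative of `f`, which
  -- makes the Duhamel solution differentiable in `L²_a`.
  obtain ⟨g, hg, hfg⟩ := exists_memCH_of_memWH (hf 1 hn1)
  have hX := memX_duhamel hμ ha hf ⟨V, hV⟩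
  have hS : IsSolution μ f uin (duhamel (convDeriv hμ ha) f uin) :=
    isSolution_duhamel hμ ha hg.contDiffOn.continuousOn hfg
  have hC1 : ∀ {w : ℝ → L2 a}, MemX (k + 1) w → ContDiffOn ℝ 1 w (Ici 0) := fun hw => by
    simpa using (hw 1 hn1).contDiffOn
  refine ⟨duhamel (convDeriv hμ ha) f uin, ⟨hX, hS⟩, fun v hv hvs t ht =>
    isSolution_unique hμ ha (hC1 hX) (hC1 hv) hS hvs ht, ?_, ?_, fun t ht =>
    hasTrace_duhamel hμ ha hF hFf hV ht, ?_⟩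
  · have h := hasTrace_traceH ha V
    rw [hV] at h
    rwa [h.trace_eq]
  · filter_upwards [hFf] with s hs
    have h := hasTrace_traceH ha (D 0 s)
    rw [show toL2 (D 0 s) = f s from hs] at h
    rwa [h.trace_eq]
  · rintro q ⟨g, hg, hfg⟩
    exact memCH_duhamel hμ ha hg hfg ⟨V, hV⟩
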